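/- A \emph{blueprint} is a commutative monoid with zero $A$ together with a (proper) pre-addition: an equivalence relation $\equiv$ on the finite formal sums of elements of $A$ that is compatible with addition and multiplication, identifies $0\in A$ with the empty sum, and satisfies $a\equiv b\Rightarrow a=b$ for $a,b\in A$. An \emph{ideal} is a subset $I\ni 0$ with $AI\subseteq I$ that contains $c$ whenever $c+\sum a_i\equiv\sum b_j$ with all $a_i,b_j\in I$; a blueprint is \emph{local} if it has exactly one maximal ideal. A \emph{locally blueprinted space} is a topological space with a sheaf of blueprints whose stalks are local; morphisms are the morphisms of blueprinted spaces that induce local morphisms on all stalks (maximal ideal maps into maximal ideal). Let $\mathbb F_{1^2}=\{0,1,-1\}$ with the pre-addition generated by $1+(-1)\equiv 0$; $\mathrm{Spec}(\mathbb F_{1^2})$ is a point. Let $\overline{\mathrm{Spec}(\mathbb Z)}$ be the space with one generic point $\eta$ and one closed point for every place of $\mathbb Q$ (every prime $p$, and $\infty$), whose closed sets are the finite sets of closed points and the whole space; for non-empty open $U$ put $$\mathscr O(U)=\{q\in\mathbb Q : |q|_v\le 1 \text{ for every place } v\in U\},$$ a multiplicative monoid with zero. Let $\mathrm{Spec}(\mathbb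 Z)=\overline{\mathrm{Spec}(\mathbb Z)}\smallsetminus\{\infty\}$. Consider the following locally blueprinted spaces over $\mathrm{Spec}(\mathbb F_{1^2})$: (1) $X=\mathrm{Spec}(\mathbb Z)$, with the monoids $\mathscr O(U)$ equipped with the pre-addition generated by $1+(-1)\equiv 0$; (2) $X=\overline{\mathrm{Spec}(\mathbb Z)}$, with the same kind of structure sheaf; (3) $X=\overline{\mathrm{Spec}(\mathbb Z)}$, where $\mathscr O(U)$ carries the usual addition of the ring $\mathscr O(U)$ if $\infty\notin U$, and the pre-addition generated by $1+(-1)\equiv0$ if $\infty\in U$. \textbf{Theorem.} In each of these cases the fiber product $X\times_{\mathbb F_{1^2}}X$ exists in the category of locally blueprinted spaces, and its underlying topological space has (Krull) dimension $2$. -/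

import Mathlib

open CategoryTheory CategoryTheory.Limits TopologicalSpace Opposite

theorem multiset_map_map_of {α β γ : Type} (f : α → β) (g : β → γ) (h : α → γ)
    (e : ∀ a, g (f a) = h a) (s : Multiset α) : (s.map f).map g = s.map h := by
  rw [Multiset.map_map]
  exact Multiset.map_congr rfl fun a _ => e a

/-! ## Blueprints -/

/-- A (proper) pre-addition on a commutative monoid with zero `A`: an equivalence relation on the
finite formal sums of elements of `A` (written as multisets) that is closed under addition and under
multiplication, identifies the zero of `A` with the empty sum, and identifies no two distinct
elements of `A`. -/
structure PreAddition (A : Type) [CommMonoidWithZero A] where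
  rel : Multiset A → Multiset A → Prop
  refl : ∀ s, rel s s
  symm : ∀ {s t}, rel s t → rel t s
  trans : ∀ {s t u}, rel s t → rel t u → rel s u
  add : ∀ {s t s' t'}, rel s t → rel s' t' → rel (s + s') (t + t')
  mul : ∀ (a : A) {s t}, rel s t → rel (s.map (a * ·)) (t.map (a * ·))
  zero : rel {0} 0
  proper : ∀ {a b}, rel {a} {b} → a = b

/-- The pre-addition on `A` induced by a jointly injective family of multiplicative maps. -/
def PreAddition.induced {A : Type} [CommMonoidWithZero A] {ι : Type} {C : ι → Type}
    [∀ i, CommMonoidWithZero (C i)] (R : ∀ i, PreAddition (C i)) (φ : ∀ i, A →*₀ C i)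
    (hφ : ∀ a b, (∀ i, φ i a = φ i b) → a = b) : PreAddition A where
  rel s t := ∀ i, (R i).rel (s.map (φ i)) (t.map (φ i))
  refl s i := (R i).refl _
  symm h i := (R i).symm (h i)
  trans h h' i := (R i).trans (h i) (h' i)
  add h h' i := by
    rw [Multiset.map_add, Multiset.map_add]
    exact (R i).add (h i) (h' i)
  mul a s t h i := by
    have := (R i).mul (φ i a) (h i)
    simpa [Multiset.map_map, Function.comp_def] using this
  zero i := by simpa using (R i).zero
  proper h := hφ _ _ fun i => (R i).proper (by simpa using h i)

/-- A blueprint: a commutative monoid with zero together with a pre-addition. -/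
structure Blpr where
  carrier : Type
  [str : CommMonoidWithZero carrier]
  pre : PreAddition carrier

namespace Blpr

instance : CoeSort Blpr Type := ⟨Blpr.carrier⟩

instance (B : Blpr) : CommMonoidWithZero B := B.str

/-- The relation `s ≡ t` between finite formal sums of elements of a blueprint. -/
def rel (B : Blpr) (s t : Multiset B) : Prop := B.pre.rel s t

/-- A morphism of blueprints: a multiplicative map that respects `0`, `1` and the pre-additions. -/
@[ext]
structure Hom (B C : Blpr) where
  map : B →*₀ C
  map_rel : ∀ {s t : Multiset B}, B.rel s t → C.rel (s.map map) (t.map map)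

instance (B C : Blpr) : FunLike (Hom B C) B C where
  coe f := f.map
  coe_injective _ _ h := Hom.ext (DFunLike.coe_injective h)

instance : Category Blpr where
  Hom := Hom
  id B := ⟨MonoidWithZeroHom.id B, fun h => by simpa using h⟩
  comp f g := ⟨g.map.comp f.map, fun h => by simpa using g.map_rel (f.map_rel h)⟩

instance : ConcreteCategory Blpr Hom where
  hom f := f
  ofHom f := f

/-- An ideal of a blueprint. -/
@[ext]
structure BIdeal (B : Blpr) where
  carrier : Set B
  zero_mem : 0 ∈ carrier
  mul_mem : ∀ (a b : B), b ∈ carrier → a * b ∈ carrier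
  rel_mem : ∀ (c : B) (s t : Multiset B), (∀ a ∈ s, a ∈ carrier) → (∀ b ∈ t, b ∈ carrier) →
    B.rel (c ::ₘ s) t → c ∈ carrier

/-- Maximal among the ideals different from the whole blueprint. -/
def BIdeal.IsMaximal {B : Blpr} (I : BIdeal B) : Prop :=
  I.carrier ≠ Set.univ ∧ ∀ J : BIdeal B, I.carrier ⊆ J.carrier → J.carrier ≠ Set.univ → J = I

/-- A blueprint is local if it has exactly one maximal ideal. -/
def IsLocal (B : Blpr) : Prop := ∃! I : BIdeal B, I.IsMaximal

/-- A morphism between local blueprints is local if it maps the maximal ideal into the maximal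
ideal. -/
def IsLocalMap {B C : Blpr} (f : Hom B C) : Prop :=
  ∀ (I : BIdeal B) (J : BIdeal C), I.IsMaximal → J.IsMaximal → ∀ a ∈ I.carrier, f a ∈ J.carrier

theorem isLocalMap_of_blueField {B C : Blpr} (f : Hom B C) (h : ∀ a : B, a = 0 ∨ IsUnit a) :
    IsLocalMap f := by
  intro I J hI _ a ha
  rcases h a with rfl | ⟨u, rfl⟩
  · have : f 0 = 0 := map_zero f.map
    rw [this]
    exact J.zero_mem
  · refine (hI.1 (Set.eq_univ_of_forall fun b => ?_)).elim
    simpa using I.mul_mem (b * ↑u⁻¹) _ ha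

theorem isLocal_of_nonunits {B : Blpr} (I : BIdeal B) (hI : ∀ a, a ∈ I.carrier ↔ ¬ IsUnit a) :
    IsLocal B := by
  have key : ∀ J : BIdeal B, J.carrier ≠ Set.univ → J.carrier ⊆ I.carrier := by
    intro J hJ a ha
    rw [hI]
    rintro ⟨u, rfl⟩
    apply hJ
    ext b
    simpa using J.mul_mem (b * ↑u⁻¹) _ ha
  have hpr : I.carrier ≠ Set.univ := fun h =>
    (hI 1).1 (h ▸ Set.mem_univ (1 : B)) isUnit_one
  refine ⟨I, ⟨hpr, fun J h1 h2 => BIdeal.ext (Set.Subset.antisymm (key J h2) h1)⟩, ?_⟩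
  rintro J ⟨h1, h2⟩
  exact (h2 I (key J h1) hpr).symm

end Blpr

/-! ## Stalks of presheaves of blueprints -/

namespace BlprStalk

variable {X : TopCat.{0}} (F : X.Presheaf Blpr) (x : X)

theorem mem_inf {x : X} {U V : Opens X} (hU : x ∈ U) (hV : x ∈ V) : x ∈ U ⊓ V := ⟨hU, hV⟩

/-- Restriction of sections. -/
abbrev res {U V : Opens X} (h : V ≤ U) (a : F.obj (op U)) : F.obj (op V) :=
  F.map (homOfLE h).op a

theorem res_res {U V W : Opens X} (h : V ≤ U) (h' : W ≤ V) (a : F.obj (op U)) :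
    res F h' (res F h a) = res F (h'.trans h) a := by
  have : F.map (homOfLE (h'.trans h)).op = F.map (homOfLE h).op ≫ F.map (homOfLE h').op := by
    rw [← F.map_comp]; rfl
  exact (congrArg (fun f : F.obj (op U) ⟶ F.obj (op W) => f a) this).symm

theorem res_self {U : Opens X} (h : U ≤ U) (a : F.obj (op U)) : res F h a = a := by
  have : F.map (homOfLE h).op = 𝟙 _ := F.map_id _
  exact congrArg (fun f : F.obj (op U) ⟶ F.obj (op U) => f a) this

theorem res_mul {U V : Opens X} (h : V ≤ U) (a b : F.obj (op U)) :
    res F h (a * b) = res F h a * res F h b :=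
  map_mul (F.map (homOfLE h).op).map a b

theorem res_one {U V : Opens X} (h : V ≤ U) : res F h 1 = 1 :=
  map_one (F.map (homOfLE h).op).map

theorem res_zero {U V : Opens X} (h : V ≤ U) : res F h 0 = 0 :=
  map_zero (F.map (homOfLE h).op).map

theorem res_rel {U V : Opens X} (h : V ≤ U) {s t : Multiset (F.obj (op U))}
    (hr : (F.obj (op U)).rel s t) :
    (F.obj (op V)).rel (s.map (res F h)) (t.map (res F h)) :=
  (F.map (homOfLE h).op).map_rel hr

/-- Sections on open neighbourhoods of `x`. -/
structure PreGerm where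
  U : Opens X
  mem : x ∈ U
  val : F.obj (op U)

/-- Two sections have the same germ if they agree on a smaller neighbourhood of `x`. -/
def germSetoid : Setoid (PreGerm F x) where
  r a b := ∃ (W : Opens X) (_ : x ∈ W) (h : W ≤ a.U) (h' : W ≤ b.U),
    res F h a.val = res F h' b.val
  iseqv :=
    { refl := fun a => ⟨a.U, a.mem, le_rfl, le_rfl, rfl⟩
      symm := fun ⟨W, hW, h, h', e⟩ => ⟨W, hW, h', h, e.symm⟩
      trans := by
        rintro a b c ⟨W, hW, h, h', e⟩ ⟨W', hW', k, k', e'⟩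
        refine ⟨W ⊓ W', ⟨hW, hW'⟩, inf_le_left.trans h, inf_le_right.trans k', ?_⟩
        rw [← res_res F h inf_le_left, e, res_res, ← res_res F k' inf_le_right, ← e', res_res] }

/-- The set of germs at `x`. -/
def Germ : Type := Quotient (germSetoid F x)

/-- The germ at `x` of a section. -/
def germ {U : Opens X} (hx : x ∈ U) (a : F.obj (op U)) : Germ F x :=
  Quotient.mk (germSetoid F x) ⟨U, hx, a⟩

variable {F x}

theorem germ_eq {U V : Opens X} {hU : x ∈ U} {hV : x ∈ V} {a : F.obj (op U)} {b : F.obj (op V)} :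
    germ F x hU a = germ F x hV b ↔
      ∃ (W : Opens X) (_ : x ∈ W) (h : W ≤ U) (h' : W ≤ V), res F h a = res F h' b :=
  Quotient.eq (r := germSetoid F x)

theorem germ_res {U V : Opens X} (hU : x ∈ U) (hV : x ∈ V) (h : V ≤ U) (a : F.obj (op U)) :
    germ F x hV (res F h a) = germ F x hU a :=
  germ_eq.2 ⟨V, hV, le_rfl, h, res_self F _ _⟩

theorem germ_surj (g : Germ F x) : ∃ (U : Opens X) (h : x ∈ U) (a : F.obj (op U)),
    germ F x h a = g := by
  induction g using Quotient.inductionOn with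
  | h p => exact ⟨p.U, p.mem, p.val, rfl⟩

/-- Multiplication of germs. -/
def germMul (g g' : Germ F x) : Germ F x :=
  Quotient.liftOn₂ g g'
    (fun p q => germ F x (U := p.U ⊓ q.U) (mem_inf p.mem q.mem)
      (res F inf_le_left p.val * res F inf_le_right q.val)) (by
    rintro ⟨U, hU, a⟩ ⟨V, hV, b⟩ ⟨U', hU', a'⟩ ⟨V', hV', b'⟩ ⟨W, hW, h, h', e⟩ ⟨Z, hZ, k, k', e'⟩
    refine germ_eq.2 ?_
    refine ⟨W ⊓ Z, ⟨hW, hZ⟩, inf_le_inf h k, inf_le_inf h' k', ?_⟩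
    simp only [res_mul, res_res] at e e' ⊢
    have e1 := congrArg (res F (inf_le_left : W ⊓ Z ≤ W)) e
    have e2 := congrArg (res F (inf_le_right : W ⊓ Z ≤ Z)) e'
    simp only [res_res] at e1 e2
    rw [e1, e2])

theorem germ_mul_inf {U V : Opens X} (hU : x ∈ U) (hV : x ∈ V) (a : F.obj (op U))
    (b : F.obj (op V)) : germMul (germ F x hU a) (germ F x hV b) =
      germ F x (U := U ⊓ V) (mem_inf hU hV) (res F inf_le_left a * res F inf_le_right b) := rfl

theorem germ_mul {U : Opens X} (hU : x ∈ U) (a b : F.obj (op U)) :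
    germMul (germ F x hU a) (germ F x hU b) = germ F x hU (a * b) := by
  rw [germ_mul_inf, ← res_mul, germ_res hU]

/-- Two germs are represented on a common neighbourhood. -/
theorem germ_surj₂ (g g' : Germ F x) : ∃ (U : Opens X) (h : x ∈ U) (a a' : F.obj (op U)),
    germ F x h a = g ∧ germ F x h a' = g' := by
  obtain ⟨U, hU, a, rfl⟩ := germ_surj g
  obtain ⟨V, hV, b, rfl⟩ := germ_surj g'
  exact ⟨U ⊓ V, mem_inf hU hV, res F inf_le_left a, res F inf_le_right b, germ_res _ _ _ _,
    germ_res _ _ _ _⟩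

instance : CommMonoidWithZero (Germ F x) where
  mul := germMul
  one := germ F x (U := ⊤) (Opens.mem_top _) 1
  zero := germ F x (U := ⊤) (Opens.mem_top _) 0
  mul_assoc := by
    intro a b c
    obtain ⟨U, hU, a, b, rfl, rfl⟩ := germ_surj₂ a b
    obtain ⟨V, hV, c, rfl⟩ := germ_surj c
    rw [← germ_res hU (V := U ⊓ V) (mem_inf hU hV) inf_le_left a,
      ← germ_res hU (V := U ⊓ V) (mem_inf hU hV) inf_le_left b,
      ← germ_res hV (V := U ⊓ V) (mem_inf hU hV) inf_le_right c]
    change germMul (germMul _ _) _ = germMul _ (germMul _ _)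
    simp only [germ_mul, mul_assoc]
  mul_comm := by
    intro a b
    obtain ⟨U, hU, a, b, rfl, rfl⟩ := germ_surj₂ a b
    change germMul _ _ = germMul _ _
    simp only [germ_mul, mul_comm]
  one_mul := by
    intro a
    obtain ⟨U, hU, a, rfl⟩ := germ_surj a
    change germMul (germ F x _ 1) _ = _
    rw [← germ_res (U := ⊤) (Opens.mem_top _) hU le_top 1, germ_mul, res_one, one_mul]
  mul_one := by
    intro a
    obtain ⟨U, hU, a, rfl⟩ := germ_surj a
    change germMul _ (germ F x _ 1) = _
    rw [← germ_res (U := ⊤) (Opens.mem_top _) hU le_top 1, germ_mul, res_one, mul_one]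
  zero_mul := by
    intro a
    obtain ⟨U, hU, a, rfl⟩ := germ_surj a
    change germMul (germ F x _ 0) _ = germ F x _ 0
    rw [← germ_res (U := ⊤) (Opens.mem_top _) hU le_top 0, germ_mul, res_zero, zero_mul]
  mul_zero := by
    intro a
    obtain ⟨U, hU, a, rfl⟩ := germ_surj a
    change germMul _ (germ F x _ 0) = germ F x _ 0
    rw [← germ_res (U := ⊤) (Opens.mem_top _) hU le_top 0, germ_mul, res_zero, mul_zero]

theorem germ_mul' {U : Opens X} (hU : x ∈ U) (a b : F.obj (op U)) :
    germ F x hU (a * b) = germ F x hU a * germ F x hU b := (germ_mul hU a b).symm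

theorem germ_one {U : Opens X} (hU : x ∈ U) : germ F x hU 1 = 1 := by
  change _ = germ F x (U := ⊤) (Opens.mem_top _) 1
  rw [← germ_res (U := ⊤) (Opens.mem_top _) hU le_top 1, res_one]

theorem germ_zero {U : Opens X} (hU : x ∈ U) : germ F x hU 0 = 0 := by
  change _ = germ F x (U := ⊤) (Opens.mem_top _) 0
  rw [← germ_res (U := ⊤) (Opens.mem_top _) hU le_top 0, res_zero]

theorem map_germ_res {U V : Opens X} (hU : x ∈ U) (hV : x ∈ V) (h : V ≤ U)
    (s : Multiset (F.obj (op U))) : (s.map (res F h)).map (germ F x hV) = s.map (germ F x hU) := by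
  rw [Multiset.map_map]
  exact Multiset.map_congr rfl fun a _ => germ_res _ _ _ _

/-- Formal sums of sections with the same germs agree on a smaller neighbourhood. -/
theorem exists_res_eq {U : Opens X} (hU : x ∈ U) (s t : Multiset (F.obj (op U)))
    (h : s.map (germ F x hU) = t.map (germ F x hU)) :
    ∃ (W : Opens X) (_ : x ∈ W) (k : W ≤ U), s.map (res F k) = t.map (res F k) := by
  induction s using Multiset.induction_on generalizing t with
  | empty =>
    refine ⟨U, hU, le_rfl, ?_⟩
    have : t = 0 := by simpa using h.symm
    rw [this]
  | cons a s ih =>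
    have ha : germ F x hU a ∈ t.map (germ F x hU) := by rw [← h]; simp
    obtain ⟨b, hb, hba⟩ := Multiset.mem_map.1 ha
    obtain ⟨t, rfl⟩ := Multiset.exists_cons_of_mem hb
    rw [Multiset.map_cons, Multiset.map_cons, hba, Multiset.cons_inj_right] at h
    obtain ⟨W, hW, k, e⟩ := ih t h
    obtain ⟨Z, hZ, l, l', e'⟩ := germ_eq.1 hba
    refine ⟨W ⊓ Z, ⟨hW, hZ⟩, inf_le_left.trans k, ?_⟩
    have e1 := congrArg (Multiset.map (res F (inf_le_left : W ⊓ Z ≤ W))) e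
    have e2 := congrArg (res F (inf_le_right : W ⊓ Z ≤ Z)) e'
    simp only [Multiset.map_map, Function.comp_def, res_res] at e1 e2
    simp only [Multiset.map_cons]
    rw [e1, e2]

/-- The relation on formal sums of germs: it holds if it holds between representing sections on some
neighbourhood of `x`. -/
def germRel (s t : Multiset (Germ F x)) : Prop :=
  ∃ (U : Opens X) (h : x ∈ U) (s' t' : Multiset (F.obj (op U))),
    (F.obj (op U)).rel s' t' ∧ s'.map (germ F x h) = s ∧ t'.map (germ F x h) = t

theorem exists_rep (s : Multiset (Germ F x)) : ∃ (U : Opens X) (h : x ∈ U)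
    (s' : Multiset (F.obj (op U))), s'.map (germ F x h) = s := by
  induction s using Multiset.induction_on with
  | empty => exact ⟨⊤, trivial, 0, rfl⟩
  | cons a s ih =>
    obtain ⟨U, hU, s', rfl⟩ := ih
    obtain ⟨V, hV, a, rfl⟩ := germ_surj a
    refine ⟨U ⊓ V, mem_inf hU hV, res F inf_le_right a ::ₘ s'.map (res F inf_le_left), ?_⟩
    rw [Multiset.map_cons, map_germ_res hU, germ_res hV]

/-- The filtered colimit of the pre-additions of the sections. -/
def germPre : PreAddition (Germ F x) where
  rel := germRel
  refl s := by
    obtain ⟨U, hU, s', h⟩ := exists_rep s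
    exact ⟨U, hU, s', s', (F.obj (op U)).pre.refl _, h, h⟩
  symm := fun ⟨U, hU, s', t', h, h1, h2⟩ => ⟨U, hU, t', s', (F.obj (op U)).pre.symm h, h2, h1⟩
  trans := by
    rintro s t u ⟨U, hU, s', t', h, rfl, rfl⟩ ⟨V, hV, t'', u', k, h1, rfl⟩
    have e : (t'.map (res F inf_le_left)).map (germ F x (U := U ⊓ V) (mem_inf hU hV)) =
        (t''.map (res F inf_le_right)).map (germ F x (U := U ⊓ V) (mem_inf hU hV)) := by
      rw [map_germ_res hU, map_germ_res hV, h1]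
    obtain ⟨W, hW, l, e⟩ := exists_res_eq _ _ _ e
    have r1 := res_rel F l (res_rel F inf_le_left h)
    have r2 := res_rel F l (res_rel F inf_le_right k)
    rw [e] at r1
    refine ⟨W, hW, _, _, (F.obj (op W)).pre.trans r1 r2, ?_, ?_⟩
    · rw [map_germ_res (U := U ⊓ V) (mem_inf hU hV), map_germ_res hU]
    · rw [map_germ_res (U := U ⊓ V) (mem_inf hU hV), map_germ_res hV]
  add := by
    rintro _ _ _ _ ⟨U, hU, s, t, h, rfl, rfl⟩ ⟨V, hV, s', t', k, rfl, rfl⟩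
    refine ⟨U ⊓ V, mem_inf hU hV, _, _,
      (F.obj (op (U ⊓ V))).pre.add (res_rel F inf_le_left h) (res_rel F inf_le_right k), ?_, ?_⟩
    · rw [Multiset.map_add, map_germ_res hU, map_germ_res hV]
    · rw [Multiset.map_add, map_germ_res hU, map_germ_res hV]
  mul := by
    rintro a _ _ ⟨U, hU, s, t, h, rfl, rfl⟩
    obtain ⟨V, hV, a, rfl⟩ := germ_surj a
    refine ⟨U ⊓ V, mem_inf hU hV, _, _,
      (F.obj (op (U ⊓ V))).pre.mul (res F inf_le_right a) (res_rel F inf_le_left h), ?_, ?_⟩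
    · rw [Multiset.map_map, Multiset.map_map, Multiset.map_map]
      refine Multiset.map_congr rfl fun b _ => ?_
      exact (germ_mul' _ _ _).trans (congrArg₂ _ (germ_res hV _ _ _) (germ_res hU _ _ _))
    · rw [Multiset.map_map, Multiset.map_map, Multiset.map_map]
      refine Multiset.map_congr rfl fun b _ => ?_
      exact (germ_mul' _ _ _).trans (congrArg₂ _ (germ_res hV _ _ _) (germ_res hU _ _ _))
  zero := ⟨⊤, trivial, {0}, 0, (F.obj (op ⊤)).pre.zero, rfl, rfl⟩
  proper := by
    rintro a b ⟨U, hU, s, t, h, h1, h2⟩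
    obtain ⟨a, rfl, rfl⟩ := Multiset.map_eq_singleton.1 h1
    obtain ⟨b, rfl, rfl⟩ := Multiset.map_eq_singleton.1 h2
    rw [(F.obj (op U)).pre.proper h]

variable (F x)

/-- The stalk of a presheaf of blueprints at a point: the filtered colimit of the blueprints of
sections on open neighbourhoods. -/
def stalk : Blpr where
  carrier := Germ F x
  pre := germPre

end BlprStalk

/-! ## Locally blueprinted spaces -/

open AlgebraicGeometry

namespace BlprSp

open BlprStalk

theorem mem_pre {X Y : PresheafedSpace.{0, 1, 0} Blpr} (f : X.Hom Y) {x : X} {U : Opens Y}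
    (hU : f.base x ∈ U) : x ∈ (Opens.map f.base).obj U := hU

/-- The map on germs at `f x` and `x` induced by a morphism of blueprinted spaces. -/
def germMap {X Y : PresheafedSpace.{0, 1, 0} Blpr} (f : X.Hom Y) (x : X) :
    Germ Y.presheaf (f.base x) → Germ X.presheaf x :=
  Quotient.lift (fun p => germ X.presheaf x (U := (Opens.map f.base).obj p.U) (mem_pre f p.mem)
    (f.c.app (op p.U) p.val)) (by
    rintro ⟨U, hU, a⟩ ⟨V, hV, b⟩ ⟨W, hW, h, h', e⟩
    have nat : ∀ {U : Opens Y} (h : W ≤ U) (a : Y.presheaf.obj (op U)),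
        f.c.app (op W) (res Y.presheaf h a) =
          res X.presheaf ((Opens.map f.base).map (homOfLE h)).le (f.c.app (op U) a) :=
      fun {U} h a => congrArg (fun g : Y.presheaf.obj (op U) ⟶ (f.base _* X.presheaf).obj (op W) =>
        g a) (f.c.naturality (homOfLE h).op)
    refine germ_eq.2 ?_
    refine ⟨(Opens.map f.base).obj W, hW, ((Opens.map f.base).map (homOfLE h)).le,
      ((Opens.map f.base).map (homOfLE h')).le, ?_⟩
    rw [← nat h, ← nat h', e])

theorem germMap_germ {X Y : PresheafedSpace.{0, 1, 0} Blpr} (f : X.Hom Y) (x : X) {U : Opens Y}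
    (hU : f.base x ∈ U) (a : Y.presheaf.obj (op U)) :
    germMap f x (germ Y.presheaf (f.base x) hU a) =
      germ X.presheaf x (U := (Opens.map f.base).obj U) (mem_pre f hU) (f.c.app (op U) a) := rfl

/-- The morphism of stalks induced by a morphism of blueprinted spaces. -/
def stalkMap {X Y : PresheafedSpace.{0, 1, 0} Blpr} (f : X.Hom Y) (x : X) :
    Blpr.Hom (stalk Y.presheaf (f.base x)) (stalk X.presheaf x) where
  map :=
    { toFun := germMap f x
      map_zero' := by
        change germMap f x (germ Y.presheaf (f.base x) (U := ⊤) (Opens.mem_top _) 0) = 0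
        rw [germMap_germ]
        exact (congrArg _ (map_zero (f.c.app (op ⊤)).map)).trans (germ_zero _)
      map_one' := by
        change germMap f x (germ Y.presheaf (f.base x) (U := ⊤) (Opens.mem_top _) 1) = 1
        rw [germMap_germ]
        exact (congrArg _ (map_one (f.c.app (op ⊤)).map)).trans (germ_one _)
      map_mul' := by
        intro a b
        obtain ⟨U, hU, a, b, rfl, rfl⟩ := germ_surj₂ a b
        change germMap f x (germMul _ _) = germMul _ _
        rw [germ_mul, germMap_germ, germMap_germ, germMap_germ, germ_mul]
        exact congrArg _ (map_mul (f.c.app (op U)).map a b) }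
  map_rel := by
    rintro _ _ ⟨U, hU, s, t, h, rfl, rfl⟩
    refine ⟨(Opens.map f.base).obj U, mem_pre f hU, _, _, (f.c.app (op U)).map_rel h, ?_, ?_⟩
    · exact (multiset_map_map_of _ _ (fun a => germ X.presheaf x (mem_pre f hU)
        (f.c.app (op U) a)) (fun _ => rfl) _).trans
        (multiset_map_map_of (germ Y.presheaf (f.base x) hU) (germMap f x) _ (fun _ => rfl) _).symm
    · exact (multiset_map_map_of _ _ (fun a => germ X.presheaf x (mem_pre f hU)
        (f.c.app (op U) a)) (fun _ => rfl) _).trans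
        (multiset_map_map_of (germ Y.presheaf (f.base x) hU) (germMap f x) _ (fun _ => rfl) _).symm

end BlprSp

/-- A locally blueprinted space: a topological space with a sheaf of blueprints whose stalks are
local blueprints. -/
structure LocBlprSp extends SheafedSpace.{1, 0, 0} Blpr where
  isLocal : ∀ x : carrier, (BlprStalk.stalk presheaf x).IsLocal

namespace LocBlprSp

/-- A local morphism: a morphism of blueprinted spaces that induces local morphisms between all
stalks. -/
@[ext]
structure Hom (X Y : LocBlprSp) extends X.toPresheafedSpace.Hom Y.toPresheafedSpace where
  isLocal : ∀ x, Blpr.IsLocalMap (BlprSp.stalkMap toHom x)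

instance : Category LocBlprSp where
  Hom := Hom
  id X :=
    { toHom := 𝟙 X.toPresheafedSpace
      isLocal := by
        intro x I J hI hJ a ha
        obtain rfl : I = J := (X.isLocal x).unique hI hJ
        obtain ⟨U, hU, a, rfl⟩ := BlprStalk.germ_surj a
        exact ha }
  comp {X Y Z} f g :=
    { toHom := (f.toHom ≫ g.toHom : X.toPresheafedSpace ⟶ Z.toPresheafedSpace)
      isLocal := by
        intro x I J hI hJ a ha
        obtain ⟨K, hK, -⟩ := Y.isLocal (f.base x)
        have h := f.isLocal x K J hK hJ _ (g.isLocal (f.base x) I K hI hK a ha)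
        obtain ⟨U, hU, a, rfl⟩ := BlprStalk.germ_surj a
        exact h }

end LocBlprSp

/-! ## Sheaves of rational constants -/

/-- The pre-addition on `ℚ` generated by `1 + (-1) ≡ 0`: no sums other than `a + (-a) ≡ 0` are
retained. Explicitly, `s ≡ t` if for every `a ≠ 0` the number of occurrences of `a` minus that of
`-a` is the same in `s` and in `t`. -/
def ratMul : PreAddition ℚ where
  rel s t := ∀ a : ℚ, a ≠ 0 → s.count a + t.count (-a) = t.count a + s.count (-a)
  refl s a _ := rfl
  symm h a ha := (h a ha).symm
  trans h h' a ha := by have := h a ha; have := h' a ha; omega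
  add h h' a ha := by
    have := h a ha; have := h' a ha
    simp only [Multiset.count_add]; omega
  mul b s t h a ha := by
    rcases eq_or_ne b 0 with rfl | hb
    · have key : ∀ (u : Multiset ℚ) (c : ℚ), c ≠ 0 → (u.map (0 * ·)).count c = 0 := by
        intro u c hc
        rw [Multiset.count_eq_zero]
        simp only [zero_mul, Multiset.mem_map, not_exists, not_and]
        exact fun _ _ h => hc h.symm
      rw [key _ _ ha, key _ _ ha, key _ _ (neg_ne_zero.2 ha), key _ _ (neg_ne_zero.2 ha)]
    · have key : ∀ (u : Multiset ℚ) (c : ℚ), (u.map (b * ·)).count c = u.count (b⁻¹ * c) := by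
        intro u c
        conv_lhs => rw [← mul_inv_cancel_left₀ hb c]
        exact Multiset.count_map_eq_count' _ _ (mul_right_injective₀ hb) _
      rw [key, key, key, key, mul_neg]
      exact h _ (mul_ne_zero (inv_ne_zero hb) ha)
  zero a ha := by simp [ha]
  proper {a b} h := by
    by_contra hab
    rcases eq_or_ne a 0 with rfl | ha
    · have hb : b ≠ 0 := fun e => hab e.symm
      have := h b hb
      have h1 : -b ≠ b := fun e => hb (by linarith)
      simp [hb, h1] at this
    · have := h a ha
      have h1 : -a ≠ a := fun e => ha (by linarith)
      simp only [Multiset.count_singleton, hab, h1, if_true, if_false] at this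
      omega

/-- `ratMul` is the smallest pre-addition on `ℚ` in which `1 + (-1) ≡ 0`. -/
theorem ratMul_le (R : PreAddition ℚ) (hR : R.rel {1, -1} 0) {s t : Multiset ℚ}
    (h : ratMul.rel s t) : R.rel s t := by
  have hpair : ∀ a : ℚ, R.rel {a, -a} 0 := fun a => by simpa using R.mul a hR
  have key : ∀ (n : ℕ) (u : Multiset ℚ), u.card = n →
      (∀ a : ℚ, a ≠ 0 → u.count a = u.count (-a)) → R.rel u 0 := by
    intro n
    induction n using Nat.strong_induction_on with
    | _ n ih =>
      intro u hn hu
      rcases u.empty_or_exists_mem with rfl | ⟨a, ha⟩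
      · exact R.refl _
      obtain ⟨u, rfl⟩ := Multiset.exists_cons_of_mem ha
      rcases eq_or_ne a 0 with rfl | h0
      · have h1 : R.rel u 0 := by
          refine ih _ (by rw [← hn]; simp) u rfl fun b hb => ?_
          have := hu b hb
          rwa [Multiset.count_cons_of_ne hb, Multiset.count_cons_of_ne (neg_ne_zero.2 hb)] at this
        simpa using R.add R.zero h1
      · have hne : -a ≠ a := fun e => h0 (by linarith)
        have hm : -a ∈ u := by
          have := hu a h0
          rw [Multiset.count_cons_self, Multiset.count_cons_of_ne hne] at this
          exact Multiset.count_pos.1 (by omega)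
        obtain ⟨u, rfl⟩ := Multiset.exists_cons_of_mem hm
        have h1 : R.rel u 0 := by
          refine ih _ (by rw [← hn]; simp) u rfl fun b hb => ?_
          have := hu b hb
          simp only [Multiset.count_cons, neg_inj] at this
          have e : (-b = a) ↔ (b = -a) := neg_eq_iff_eq_neg
          simp only [e] at this
          omega
        simpa using R.add (hpair a) h1
  have hneg : ∀ u : Multiset ℚ, R.rel (u.map (fun a => -a) + u) 0 := by
    intro u
    refine key _ _ rfl fun a _ => ?_
    have e : ∀ c, (u.map (fun a => -a)).count c = u.count (-c) := fun c => by
      conv_lhs => rw [← neg_neg c]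
      exact Multiset.count_map_eq_count' _ _ neg_injective _
    simp only [Multiset.count_add, e, neg_neg]
    omega
  have h1 : R.rel (s + t.map (fun a => -a)) 0 := by
    refine key _ _ rfl fun a ha => ?_
    have e : ∀ c, (t.map (fun a => -a)).count c = t.count (-c) := fun c => by
      conv_lhs => rw [← neg_neg c]
      exact Multiset.count_map_eq_count' _ _ neg_injective _
    simp only [Multiset.count_add, e, neg_neg]
    have := h a ha
    omega
  have h2 := R.add h1 (R.refl t)
  have h3 := R.add (R.refl s) (hneg t)
  rw [zero_add] at h2
  rw [add_zero, ← add_assoc] at h3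
  exact R.trans (R.symm h3) h2

/-- The pre-addition on `ℚ` given by its usual addition. -/
def ratAdd : PreAddition ℚ where
  rel s t := s.sum = t.sum
  refl s := rfl
  symm h := h.symm
  trans h h' := h.trans h'
  add h h' := by rw [Multiset.sum_add, Multiset.sum_add, h, h']
  mul a s t h := by rw [Multiset.sum_map_mul_left, Multiset.sum_map_mul_left]; simp [h]
  zero := by simp
  proper h := by simpa using h

/-- At every point `x` of a space, a multiplicatively closed set `A x` of rational numbers with a
pre-addition in which `1 + (-1) ≡ 0`, such that every rational number lies in `A x` for an open set of points `x`, and the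
non-units of `A x` form an ideal. -/
structure RatModel (X : Type) [TopologicalSpace X] where
  A : X → Submonoid ℚ
  pre : X → PreAddition ℚ
  zero_mem : ∀ x, 0 ∈ A x
  neg_one_mem : ∀ x, -1 ∈ A x
  neg_one_rel : ∀ x, (pre x).rel {1, -1} 0
  isOpen : ∀ q : ℚ, IsOpen {x | q ∈ A x}
  unit_rel : ∀ (x : X) (c : ℚ) (s t : Multiset ℚ), c ∈ A x → c ≠ 0 → c⁻¹ ∈ A x →
    (∀ a ∈ s, a ∈ A x ∧ (a = 0 ∨ a⁻¹ ∉ A x)) → (∀ a ∈ t, a ∈ A x ∧ (a = 0 ∨ a⁻¹ ∉ A x)) →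
    ¬ (pre x).rel (c ::ₘ s) t

namespace RatModel

variable {X : Type} [TopologicalSpace X] (M : RatModel X)

/-- The sections over `U`: constant functions on `U` with value in `A x` for all `x ∈ U`; so these
are the rational numbers in `⋂ x ∈ U, A x` if `U` is non-empty, and there is one section over the
empty set. -/
def Sec (U : Opens X) : Type := {f : U → ℚ // ∃ q : ℚ, ∀ x : U, f x = q ∧ q ∈ M.A x}

namespace Sec

variable {M} {U V : Opens X}

theorem ext {f g : M.Sec U} (h : ∀ x, f.1 x = g.1 x) : f = g := Subtype.ext (funext h)

instance : Zero (M.Sec U) := ⟨0, 0, fun x => ⟨rfl, M.zero_mem x⟩⟩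

instance : One (M.Sec U) := ⟨1, 1, fun x => ⟨rfl, (M.A x).one_mem⟩⟩

instance : Mul (M.Sec U) where
  mul f g := ⟨f.1 * g.1, by
    obtain ⟨p, hp⟩ := f.2
    obtain ⟨q, hq⟩ := g.2
    exact ⟨p * q, fun x => ⟨by rw [Pi.mul_apply, (hp x).1, (hq x).1],
      (M.A x).mul_mem (hp x).2 (hq x).2⟩⟩⟩

instance : CommMonoidWithZero (M.Sec U) where
  mul_assoc a b c := Subtype.ext (mul_assoc a.1 b.1 c.1)
  mul_comm a b := Subtype.ext (mul_comm a.1 b.1)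
  one_mul a := Subtype.ext (one_mul a.1)
  mul_one a := Subtype.ext (mul_one a.1)
  zero_mul a := Subtype.ext (zero_mul a.1)
  mul_zero a := Subtype.ext (mul_zero a.1)

/-- The value of a section at a point. -/
def eval (x : U) : M.Sec U →*₀ ℚ where
  toFun f := f.1 x
  map_zero' := rfl
  map_one' := rfl
  map_mul' _ _ := rfl

/-- Restriction of functions. -/
def restrict (h : V ≤ U) : M.Sec U →*₀ M.Sec V where
  toFun f := ⟨fun x => f.1 ⟨x, h x.2⟩, by
    obtain ⟨q, hq⟩ := f.2
    exact ⟨q, fun x => hq ⟨x, h x.2⟩⟩⟩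
  map_zero' := rfl
  map_one' := rfl
  map_mul' _ _ := rfl

end Sec

/-- The blueprint of sections over `U`; sums of sections are related if their values are related at
every point of `U`. -/
def secBlpr (U : Opens X) : Blpr where
  carrier := M.Sec U
  pre := PreAddition.induced (fun x : U => M.pre x) Sec.eval fun _ _ h => Sec.ext h

/-- The presheaf of sections. -/
def presheaf : (TopCat.of X).Presheaf Blpr where
  obj U := M.secBlpr U.unop
  map {U V} i :=
    { map := Sec.restrict i.unop.le
      map_rel := by
        intro s t h x
        have e := multiset_map_map_of (Sec.restrict (M := M) i.unop.le) (Sec.eval x)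
          (Sec.eval ⟨x.1, i.unop.le x.2⟩) fun _ => rfl
        exact (congrArg₂ (M.pre x.1).rel (e s) (e t)).mpr (h ⟨x.1, i.unop.le x.2⟩) }

/-- The presheaf of sections is a sheaf of blueprints. -/
theorem isSheaf [PreirreducibleSpace X] : M.presheaf.IsSheaf := by
  intro E
  rw [← isSheaf_iff_isSheaf_of_type]
  refine TopCat.Presheaf.isSheaf_of_isSheafUniqueGluing_types (X := TopCat.of X)
    (M.presheaf ⋙ coyoneda.obj (op E)) ?_
  intro ι U sf hc
  have hval : ∀ (i j : ι) (x : X) (hi : x ∈ U i) (hj : x ∈ U j) (e : E),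
      ((sf i).map e).1 ⟨x, hi⟩ = ((sf j).map e).1 ⟨x, hj⟩ := by
    intro i j x hi hj e
    have h1 : (sf i ≫ M.presheaf.map (Opens.infLELeft (U i) (U j)).op : E ⟶ _) =
        sf j ≫ M.presheaf.map (Opens.infLERight (U i) (U j)).op := hc i j
    exact congrArg (fun g : E ⟶ M.secBlpr (U i ⊓ U j) => (g.map e).1 ⟨x, hi, hj⟩) h1
  let W : Opens X := iSup U
  have hex : ∀ x : W, ∃ i, x.1 ∈ U i := fun x => Opens.mem_iSup.1 x.2
  choose k hk using hex
  let v : E → W → ℚ := fun e x => ((sf (k x)).map e).1 ⟨x.1, hk x⟩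
  have hv : ∀ (e : E) (i : ι) (x : X) (hi : x ∈ U i) (hx : x ∈ W),
      v e ⟨x, hx⟩ = ((sf i).map e).1 ⟨x, hi⟩ := fun e i x hi hx => hval _ _ _ _ _ _
  have hconst : ∀ e (x y : W), v e x = v e y := by
    intro e x y
    obtain ⟨z, hz, hz'⟩ := nonempty_preirreducible_inter (U (k x)).isOpen (U (k y)).isOpen
      ⟨_, hk x⟩ ⟨_, hk y⟩
    obtain ⟨p, hp⟩ := ((sf (k x)).map e).2
    obtain ⟨q, hq⟩ := ((sf (k y)).map e).2
    have h1 := (hp ⟨x.1, hk x⟩).1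
    have h2 := (hp ⟨z, hz⟩).1
    have h3 := (hq ⟨y.1, hk y⟩).1
    have h4 := (hq ⟨z, hz'⟩).1
    exact h1.trans (h2.symm.trans ((hval _ _ _ _ _ _).trans (h4.trans h3.symm)))
  have hmem : ∀ e, ∃ q : ℚ, ∀ x : W, v e x = q ∧ q ∈ M.A x := by
    intro e
    by_cases hne : Nonempty W
    · obtain ⟨x₀⟩ := hne
      refine ⟨v e x₀, fun x => ⟨hconst e x x₀, ?_⟩⟩
      obtain ⟨q, hq⟩ := ((sf (k x)).map e).2
      have h := hq ⟨x.1, hk x⟩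
      rw [← hconst e x x₀]
      change ((sf (k x)).map e).1 ⟨x.1, hk x⟩ ∈ _
      rw [h.1]
      exact h.2
    · exact ⟨0, fun x => (hne ⟨x⟩).elim⟩
  let w : E ⟶ M.secBlpr (iSup U) :=
    { map :=
        { toFun := fun e => ⟨v e, hmem e⟩
          map_zero' := Sec.ext fun x =>
            congrArg (fun g : M.Sec (U (k x)) => g.1 ⟨x.1, hk x⟩) (map_zero (sf (k x)).map)
          map_one' := Sec.ext fun x =>
            congrArg (fun g : M.Sec (U (k x)) => g.1 ⟨x.1, hk x⟩) (map_one (sf (k x)).map)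
          map_mul' := fun a b => Sec.ext fun x =>
            congrArg (fun g : M.Sec (U (k x)) => g.1 ⟨x.1, hk x⟩) (map_mul (sf (k x)).map a b) }
      map_rel := by
        intro s t h x
        have := (sf (k x)).map_rel h ⟨x.1, hk x⟩
        have e := multiset_map_map_of (sf (k x)).map (Sec.eval (M := M) ⟨x.1, hk x⟩)
          (fun a => v a x) fun _ => rfl
        have e' := multiset_map_map_of (fun a => (⟨v a, hmem a⟩ : M.Sec W)) (Sec.eval (M := M) x)
          (fun a => v a x) fun _ => rfl
        exact (congrArg₂ (M.pre x.1).rel ((e' s).trans (e s).symm)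
          ((e' t).trans (e t).symm)).mpr this }
  refine ⟨w, ?_, ?_⟩
  · intro i
    exact Blpr.Hom.ext (MonoidWithZeroHom.ext fun e => Sec.ext fun x =>
      hv e i x.1 x.2 (Opens.mem_iSup.2 ⟨i, x.2⟩))
  · intro w' hw'
    refine Blpr.Hom.ext (MonoidWithZeroHom.ext fun e => Sec.ext fun x => ?_)
    have h1 : (w' ≫ M.presheaf.map (Opens.leSupr U (k x)).op : E ⟶ _) = sf (k x) := hw' (k x)
    exact congrArg (fun g : E ⟶ M.secBlpr (U (k x)) => (g.map e).1 ⟨x.1, hk x⟩) h1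

open BlprStalk in
/-- The stalks are local; the maximal ideal consists of the germs of value `0` or with inverse
value not in `A x`. -/
theorem isLocal_stalk (x : X) : (stalk M.presheaf x).IsLocal := by
  have hv : ∃ v : Germ M.presheaf x → ℚ, ∀ (U : Opens (TopCat.of X)) (hU : x ∈ U)
      (f : M.presheaf.obj (op U)), v (germ M.presheaf x hU f) = (show M.Sec U from f).1 ⟨x, hU⟩ := by
    refine ⟨Quotient.lift (fun p => (p.val : M.Sec p.U).1 ⟨x, p.mem⟩) ?_, fun U hU f => rfl⟩
    rintro ⟨U, hU, a⟩ ⟨V, hV, b⟩ ⟨W, hW, h, h', e⟩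
    exact congrArg (fun g : M.Sec W => g.1 ⟨x, hW⟩) e
  obtain ⟨v, hv⟩ := hv
  have hvA : ∀ g, v g ∈ M.A x := by
    intro g
    obtain ⟨U, hU, a, rfl⟩ := germ_surj g
    rw [hv]
    obtain ⟨q, hq⟩ := a.2
    rw [(hq ⟨x, hU⟩).1]
    exact (hq ⟨x, hU⟩).2
  have hmul : ∀ g g', v (g * g') = v g * v g' := by
    intro g g'
    obtain ⟨U, hU, a, b, rfl, rfl⟩ := germ_surj₂ g g'
    rw [← germ_mul', hv, hv, hv]
    rfl
  have hone : v 1 = 1 := by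
    rw [← germ_one (F := M.presheaf) (x := x) (U := ⊤) (Opens.mem_top _), hv]; rfl
  have hzero : v 0 = 0 := by
    rw [← germ_zero (F := M.presheaf) (x := x) (U := ⊤) (Opens.mem_top _), hv]; rfl
  have hunit : ∀ g, ¬ IsUnit g ↔ v g = 0 ∨ (v g)⁻¹ ∉ M.A x := by
    intro g
    rw [← not_iff_not, not_not, not_or, not_not]
    constructor
    · rintro ⟨u, rfl⟩
      have h1 : v ↑u * v ↑u⁻¹ = 1 := by rw [← hmul, Units.mul_inv, hone]
      refine ⟨fun h => by rw [h, zero_mul] at h1; exact zero_ne_one h1, ?_⟩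
      rw [inv_eq_of_mul_eq_one_right h1]
      exact hvA _
    · rintro ⟨h0, hinv⟩
      obtain ⟨U, hU, a, rfl⟩ := germ_surj g
      rw [hv] at h0 hinv
      obtain ⟨q, hq⟩ := a.2
      rw [(hq ⟨x, hU⟩).1] at h0 hinv
      let W : Opens X := U ⊓ ⟨_, M.isOpen q⁻¹⟩
      have hW : x ∈ W := ⟨hU, hinv⟩
      let b : M.presheaf.obj (op W) :=
        (⟨fun _ => q⁻¹, q⁻¹, fun y => ⟨rfl, y.2.2⟩⟩ : M.Sec W)
      have hWU : W ≤ U := inf_le_left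
      have key : germ M.presheaf x hU a * germ M.presheaf x hW b = 1 := by
        rw [← germ_res hU hW hWU a, ← germ_mul', ← germ_one hW]
        refine congrArg (germ M.presheaf x hW) (Sec.ext fun y => ?_)
        change a.1 ⟨y.1, hWU y.2⟩ * q⁻¹ = 1
        rw [(hq ⟨y.1, hWU y.2⟩).1, mul_inv_cancel₀ h0]
      exact IsUnit.of_mul_eq_one _ key
  refine Blpr.isLocal_of_nonunits
    { carrier := {g | ¬ IsUnit (g : Germ M.presheaf x)}
      zero_mem := (hunit 0).2 (Or.inl hzero)
      mul_mem := fun a b hb h => hb (isUnit_of_mul_isUnit_right h)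
      rel_mem := ?_ } fun _ => Iff.rfl
  rintro c s t hs ht ⟨U, hU, s', t', hr, h1, h2⟩ hc
  have hr' := hr ⟨x, hU⟩
  have hev : ∀ u : Multiset (M.Sec U), u.map (Sec.eval ⟨x, hU⟩) =
      Multiset.map v (Multiset.map (germ M.presheaf x hU) u) := by
    intro u
    exact (multiset_map_map_of (germ M.presheaf x hU) v _ (fun a => hv U hU a) u).symm
  have e1 := (hev s').trans (congrArg (Multiset.map v) h1)
  have e2 := (hev t').trans (congrArg (Multiset.map v) h2)
  have e1 := e1.trans (Multiset.map_cons v c s)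
  have hc' : v c ≠ 0 ∧ (v c)⁻¹ ∈ M.A x := by
    have := (not_iff_not.2 (hunit c)).1 (not_not.2 hc)
    rwa [not_or, not_not] at this
  refine M.unit_rel x (v c) (s.map v) (t.map v) (hvA c) hc'.1 hc'.2 ?_ ?_ ?_
  · intro a ha
    obtain ⟨g, hg, rfl⟩ := Multiset.mem_map.1 ha
    exact ⟨hvA g, (hunit g).1 (hs g hg)⟩
  · intro a ha
    obtain ⟨g, hg, rfl⟩ := Multiset.mem_map.1 ha
    exact ⟨hvA g, (hunit g).1 (ht g hg)⟩
  · exact (congrArg₂ (M.pre x).rel e1 e2).mp hr'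

/-- The locally blueprinted space defined by the sheaf of sections. -/
def toLocBlprSp [PreirreducibleSpace X] : LocBlprSp where
  carrier := TopCat.of X
  presheaf := M.presheaf
  IsSheaf := M.isSheaf
  isLocal := M.isLocal_stalk

end RatModel

/-! ## The base and the arithmetic curve -/

theorem ratMul_unit_rel (A : Submonoid ℚ) (hneg : -1 ∈ A) (c : ℚ) (s t : Multiset ℚ) (hc : c ≠ 0)
    (hci : c⁻¹ ∈ A) (hs : ∀ a ∈ s, a ∈ A ∧ (a = 0 ∨ a⁻¹ ∉ A))
    (ht : ∀ a ∈ t, a ∈ A ∧ (a = 0 ∨ a⁻¹ ∉ A)) : ¬ ratMul.rel (c ::ₘ s) t := by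
  intro h
  have h1 := h c hc
  have hn : (-c)⁻¹ ∈ A := by
    have := A.mul_mem hneg hci
    rwa [inv_neg, ← neg_one_mul]
  have key : ∀ u : Multiset ℚ, (∀ a ∈ u, a ∈ A ∧ (a = 0 ∨ a⁻¹ ∉ A)) →
      u.count c = 0 ∧ u.count (-c) = 0 := by
    intro u hu
    rw [Multiset.count_eq_zero, Multiset.count_eq_zero]
    exact ⟨fun h => (hu _ h).2.elim hc fun h => h hci,
      fun h => (hu _ h).2.elim (neg_ne_zero.2 hc) fun h => h hn⟩
  have hne : -c ≠ c := fun e => hc (by linarith)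
  rw [Multiset.count_cons_self, Multiset.count_cons_of_ne hne, (key s hs).1, (key s hs).2,
    (key t ht).1, (key t ht).2] at h1
  omega

theorem ratMul_neg_one : ratMul.rel {1, -1} 0 := by
  intro a _
  have h1 : -a = 1 ↔ a = -1 := neg_eq_iff_eq_neg
  simp [Multiset.insert_eq_cons, Multiset.count_cons, Multiset.count_singleton, h1, add_comm]

/-- The blueprint `𝔽_{1²} = {0, 1, -1}` with the pre-addition generated by `1 + (-1) ≡ 0`, at the
only point of a one-point space. -/
def f12Model : RatModel PUnit where
  A _ :=
    { carrier := {0, 1, -1}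
      one_mem' := by simp
      mul_mem' := by
        rintro a b (rfl | rfl | rfl) (rfl | rfl | rfl) <;> simp }
  pre _ := ratMul
  zero_mem _ := Or.inl rfl
  neg_one_mem _ := Or.inr (Or.inr rfl)
  neg_one_rel _ := ratMul_neg_one
  isOpen _ := isOpen_discrete _
  unit_rel _ c s t _ hc hci hs ht :=
    ratMul_unit_rel _ (Or.inr (Or.inr rfl)) c s t hc hci hs ht

/-- `Spec 𝔽_{1²}`. Since all non-zero elements of `𝔽_{1²}` are units, its only prime ideal is
`{0}`, and the spectrum is a point with `𝔽_{1²}` as blueprint of global sections. -/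
def specF12 : LocBlprSp := f12Model.toLocBlprSp

open BlprStalk in
/-- Every element of `𝔽_{1²}` is zero or a unit. -/
theorem f12_stalk (x : TopCat.of PUnit) (g : Germ f12Model.presheaf x) : g = 0 ∨ IsUnit g := by
  obtain ⟨U, hU, f, rfl⟩ := germ_surj g
  have hq : ∃ q : ℚ, ∀ y : U, (f : f12Model.Sec U).1 y = q ∧ q ∈ f12Model.A y :=
    @Subtype.property _ (fun h : U → ℚ => ∃ q : ℚ, ∀ y, h y = q ∧ q ∈ f12Model.A y) f
  obtain ⟨q, hq⟩ := hq
  by_cases h0 : q = 0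
  · left
    rw [← germ_zero hU]
    exact congrArg _ (RatModel.Sec.ext fun y => (hq y).1.trans h0)
  · right
    have hqq : q * q = 1 := by
      rcases (hq ⟨x, hU⟩).2 with rfl | rfl | rfl
      · exact (h0 rfl).elim
      · norm_num
      · norm_num
    have hff : f * f = 1 := RatModel.Sec.ext fun y => by
      change (f : f12Model.Sec U).1 y * (f : f12Model.Sec U).1 y = 1
      rw [(hq y).1, hqq]
    refine IsUnit.of_mul_eq_one (germ f12Model.presheaf x hU f) ?_
    rw [← germ_mul', hff, germ_one]

namespace RatModel

variable {X : Type} [TopologicalSpace X] (M : RatModel X)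

theorem f12_mem (x : X) {q : ℚ} (hq : q ∈ f12Model.A PUnit.unit) : q ∈ M.A x := by
  rcases hq with rfl | rfl | rfl
  exacts [M.zero_mem x, (M.A x).one_mem, M.neg_one_mem x]

/-- The constant map to the one-point space. -/
def toPoint : TopCat.of X ⟶ TopCat.of PUnit :=
  TopCat.ofHom ⟨fun _ => PUnit.unit, continuous_const⟩

/-- The inclusion of `𝔽_{1²}` into the sections. -/
def f12Map (U : Opens (TopCat.of PUnit)) :
    f12Model.Sec U →*₀ M.Sec ((Opens.map (toPoint (X := X))).obj U) where
  toFun f := ⟨fun x => f.1 ⟨PUnit.unit, x.2⟩, by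
    obtain ⟨q, hq⟩ := f.2
    exact ⟨q, fun x => ⟨(hq _).1, M.f12_mem _ (hq ⟨PUnit.unit, x.2⟩).2⟩⟩⟩
  map_zero' := rfl
  map_one' := rfl
  map_mul' _ _ := rfl

/-- The structure morphism to `Spec 𝔽_{1²}`, given by the inclusions of `𝔽_{1²}` into the
blueprints of sections. -/
def toSpecF12 [PreirreducibleSpace X] : M.toLocBlprSp ⟶ specF12 where
  base := toPoint
  c :=
    { app := fun U =>
        { map := M.f12Map U.unop
          map_rel := by
            intro s t h x
            have h1 := ratMul_le (M.pre x.1) (M.neg_one_rel x.1) (h ⟨PUnit.unit, x.2⟩)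
            have e := multiset_map_map_of (M.f12Map U.unop) (Sec.eval x)
              (Sec.eval (M := f12Model) ⟨PUnit.unit, x.2⟩) fun _ => rfl
            exact (congrArg₂ (M.pre x.1).rel (e s) (e t)).mpr h1 }
      naturality := fun _ _ _ => rfl }
  isLocal := fun x => Blpr.isLocalMap_of_blueField _ (f12_stalk PUnit.unit)

end RatModel

/-- The places of `ℚ` (its non-trivial absolute values up to equivalence). -/
inductive Place
  | finite (p : Nat.Primes)
  | infinite

/-- The absolute value of a place. -/
def Place.norm : Place → ℚ → ℚ
  | finite p, q => padicNorm p q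
  | infinite, q => |q|

theorem Place.norm_one (v : Place) : v.norm 1 = 1 := by
  cases v <;> simp [Place.norm]

theorem Place.norm_zero (v : Place) : v.norm 0 = 0 := by
  cases v <;> simp [Place.norm]

theorem Place.norm_neg (v : Place) (q : ℚ) : v.norm (-q) = v.norm q := by
  cases v <;> simp [Place.norm]

theorem Place.norm_mul (v : Place) (q r : ℚ) : v.norm (q * r) = v.norm q * v.norm r := by
  cases v with
  | finite p => have := Fact.mk p.2; simp [Place.norm]
  | infinite => simp [Place.norm, abs_mul]

theorem Place.norm_nonneg (v : Place) (q : ℚ) : 0 ≤ v.norm q := by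
  cases v with
  | finite p => exact padicNorm.nonneg q
  | infinite => exact abs_nonneg q

theorem Place.finite_norm_gt (q : ℚ) : {v : Place | ¬ v.norm q ≤ 1}.Finite := by
  have h : {v : Place | ¬ v.norm q ≤ 1} ⊆
      insert Place.infinite (Place.finite '' {p : Nat.Primes | (p : ℕ) ∣ q.den}) := by
    rintro (p | _) hv
    · refine Or.inr ⟨p, ?_, rfl⟩
      by_contra hp
      apply hv
      have := Fact.mk p.2
      have h1 : padicNorm p (q.den : ℚ) = 1 := padicNorm.nat_eq_one_iff _ |>.2 hp
      have h2 : padicNorm p q = padicNorm p (q.num : ℚ) := by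
        conv_lhs => rw [← Rat.num_div_den q, padicNorm.div, h1, div_one]
      change padicNorm p q ≤ 1
      rw [h2]
      exact padicNorm.of_int _
    · exact Or.inl rfl
  refine Set.Finite.subset ((Set.Finite.image _ ?_).insert _) h
  refine Set.Finite.of_finite_image (f := fun p : Nat.Primes => (p : ℕ)) ?_
    Subtype.val_injective.injOn
  refine (Set.finite_le_nat q.den).subset ?_
  rintro _ ⟨p, hp, rfl⟩
  exact Nat.le_of_dvd q.den_pos hp

/-- The points of an arithmetic curve: a generic point, and a closed point for every place
in `S`. -/
inductive ArithPt (S : Set Place)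
  | generic
  | closed (v : S)

namespace ArithPt

variable (S : Set Place)

/-- The closed sets are the whole space and the finite sets of closed points. -/
instance : TopologicalSpace (ArithPt S) where
  IsOpen U := U = ∅ ∨ generic ∈ U ∧ Uᶜ.Finite
  isOpen_univ := Or.inr ⟨trivial, by simp⟩
  isOpen_inter := by
    rintro U V (rfl | ⟨h, h'⟩) (rfl | ⟨k, k'⟩)
    · simp
    · simp
    · simp
    · right
      rw [Set.compl_inter]
      exact ⟨⟨h, k⟩, h'.union k'⟩
  isOpen_sUnion := by
    intro T hT
    by_cases h : ∃ U ∈ T, U ≠ ∅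
    · obtain ⟨U, hU, hne⟩ := h
      obtain ⟨h1, h2⟩ := (hT U hU).resolve_left hne
      exact Or.inr ⟨⟨U, hU, h1⟩, h2.subset (Set.compl_subset_compl.2 (Set.subset_sUnion_of_mem hU))⟩
    · left
      push Not at h
      exact Set.sUnion_eq_empty.2 h

variable {S}

theorem isOpen_iff {U : Set (ArithPt S)} : IsOpen U ↔ U = ∅ ∨ generic ∈ U ∧ Uᶜ.Finite := Iff.rfl

instance : PreirreducibleSpace (ArithPt S) where
  isPreirreducible_univ := by
    rintro U V hU hV ⟨x, -, hx⟩ ⟨y, -, hy⟩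
    have h1 := (isOpen_iff.1 hU).resolve_left fun h => by simp [h] at hx
    have h2 := (isOpen_iff.1 hV).resolve_left fun h => by simp [h] at hy
    exact ⟨generic, trivial, h1.1, h2.1⟩

/-- The stalk at a point, as a subset of `ℚ`: all of `ℚ` at the generic point, and the elements of
absolute value at most `1` at the point of a place. -/
def sub : ArithPt S → Submonoid ℚ
  | generic => ⊤
  | closed v =>
    { carrier := {q | v.1.norm q ≤ 1}
      one_mem' := v.1.norm_one.le
      mul_mem' := fun {a b} ha hb => by
        change v.1.norm (a * b) ≤ 1
        rw [v.1.norm_mul]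
        exact mul_le_one₀ ha (v.1.norm_nonneg b) hb }

theorem sub_zero_mem (x : ArithPt S) : 0 ∈ x.sub := by
  cases x with
  | generic => trivial
  | closed v => exact v.1.norm_zero.trans_le zero_le_one

theorem sub_neg_one_mem (x : ArithPt S) : -1 ∈ x.sub := by
  cases x with
  | generic => trivial
  | closed v => exact ((v.1.norm_neg 1).trans v.1.norm_one).le

theorem sub_isOpen (q : ℚ) : IsOpen {x : ArithPt S | q ∈ x.sub} := by
  refine Or.inr ⟨trivial, ?_⟩
  refine (((Place.finite_norm_gt q).preimage Subtype.val_injective.injOn).image closed).subset ?_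
  rintro (_ | v) hx
  · exact (hx trivial).elim
  · exact ⟨v, hx, rfl⟩

/-- The pre-addition that retains the addition of `ℚ` at the generic point and at the finite
places, and only `a + (-a) ≡ 0` at the infinite place. -/
def ringPre : ArithPt S → PreAddition ℚ
  | closed ⟨Place.infinite, _⟩ => ratMul
  | _ => ratAdd

end ArithPt

/-- The curve whose blueprints of sections are multiplicative sets of rational numbers, with the
pre-addition generated by `1 + (-1) ≡ 0`. -/
def mulModel (S : Set Place) : RatModel (ArithPt S) where
  A := ArithPt.sub
  pre _ := ratMul
  zero_mem := ArithPt.sub_zero_mem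
  neg_one_mem := ArithPt.sub_neg_one_mem
  neg_one_rel _ := ratMul_neg_one
  isOpen := ArithPt.sub_isOpen
  unit_rel x c s t _ hc hci hs ht :=
    ratMul_unit_rel _ x.sub_neg_one_mem c s t hc hci hs ht

/-- The curve with the same topological space and multiplicative sets of sections, which retains
the whole addition of `ℚ` away from the infinite place. -/
def ringModel (S : Set Place) : RatModel (ArithPt S) where
  A := ArithPt.sub
  pre := ArithPt.ringPre
  zero_mem := ArithPt.sub_zero_mem
  neg_one_mem := ArithPt.sub_neg_one_mem
  neg_one_rel
    | .generic => by simp [ArithPt.ringPre, ratAdd]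
    | .closed ⟨.finite p, _⟩ => by simp [ArithPt.ringPre, ratAdd]
    | .closed ⟨.infinite, _⟩ => ratMul_neg_one
  isOpen := ArithPt.sub_isOpen
  unit_rel x c s t hcA hc hci hs ht := by
    rcases x with _ | ⟨p | _, hv⟩
    · intro h
      have key : ∀ u : Multiset ℚ, (∀ a ∈ u, a ∈ (⊤ : Submonoid ℚ) ∧
          (a = 0 ∨ a⁻¹ ∉ (⊤ : Submonoid ℚ))) → u.sum = 0 := fun u hu =>
        Multiset.sum_eq_zero fun a ha => (hu a ha).2.resolve_right fun h => h trivial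
      have h1 : (c ::ₘ s).sum = t.sum := h
      rw [Multiset.sum_cons, key s hs, key t ht, add_zero] at h1
      exact hc h1
    · intro h
      have := Fact.mk p.2
      have h1 : (c ::ₘ s).sum = t.sum := h
      have hlt : ∀ a : ℚ, padicNorm p a ≤ 1 ∧ (a = 0 ∨ ¬ padicNorm p a⁻¹ ≤ 1) →
          padicNorm p a < 1 := by
        rintro a ⟨ha, rfl | ha'⟩
        · simp
        · refine lt_of_le_of_ne ha fun e => ha' ?_
          have h2 : padicNorm p (a * a⁻¹) = padicNorm p a * padicNorm p a⁻¹ := padicNorm.mul _ _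
          have h3 : a ≠ 0 := by rintro rfl; simp at e
          rw [mul_inv_cancel₀ h3, e, one_mul, padicNorm.one] at h2
          exact h2.symm.le
      have key : ∀ u : Multiset ℚ, (∀ a ∈ u, padicNorm p a ≤ 1 ∧
          (a = 0 ∨ ¬ padicNorm p a⁻¹ ≤ 1)) → padicNorm p u.sum < 1 := by
        intro u
        induction u using Multiset.induction_on with
        | empty => intro _; simp
        | cons a u ih =>
          intro hu
          rw [Multiset.sum_cons]
          exact padicNorm.nonarchimedean.trans_lt (max_lt (hlt a (hu a (by simp)))
            (ih fun b hb => hu b (by simp [hb])))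
      have hcs : c = t.sum - s.sum := by
        rw [Multiset.sum_cons] at h1
        linarith
      have h4 : padicNorm p c < 1 := by
        rw [hcs]
        exact padicNorm.sub.trans_lt (max_lt (key t ht) (key s hs))
      have h5 : padicNorm p (c * c⁻¹) = padicNorm p c * padicNorm p c⁻¹ := padicNorm.mul _ _
      rw [mul_inv_cancel₀ hc, padicNorm.one] at h5
      have h6 : padicNorm p c⁻¹ ≤ 1 := hci
      have h7 := padicNorm.nonneg (p := p) c
      nlinarith
    · exact ratMul_unit_rel _ (ArithPt.sub_neg_one_mem (S := S) (.closed ⟨.infinite, hv⟩))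
        c s t hc hci hs ht

/-- `Spec ℤ` as a locally blueprinted space: a closed point for every prime number and a generic
point, and over a non-empty open set the multiplicative monoid of regular functions, with
`1 + (-1) ≡ 0`. -/
def specZ : LocBlprSp := (mulModel {v | v ≠ Place.infinite}).toLocBlprSp

/-- The structure morphism of `Spec ℤ`. -/
def specZ.toF12 : specZ ⟶ specF12 := (mulModel {v | v ≠ Place.infinite}).toSpecF12

/-- The completion of `Spec ℤ`, with the point of the infinite place added. -/
def specZBar : LocBlprSp := (mulModel Set.univ).toLocBlprSp

/-- The structure morphism of the completion. -/
def specZBar.toF12 : specZBar ⟶ specF12 := (mulModel Set.univ).toSpecF12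

/-- The completion of `Spec ℤ`, where the sections over open sets that avoid the infinite place are
rings, and the sections over other non-empty open sets are multiplicative monoids with
`1 + (-1) ≡ 0`. -/
def specZBarRing : LocBlprSp := (ringModel Set.univ).toLocBlprSp

/-- The structure morphism of the completion with ring structure away from infinity. -/
def specZBarRing.toF12 : specZBarRing ⟶ specF12 := (ringModel Set.univ).toSpecF12

/-!
The base `Spec 𝔽_{1²}` receives at most one morphism from any locally blueprinted space, because
the image of `-1` is determined by `1 + (-1) ≡ 0` (`specF12.hom_subsingleton`). Fiber products
over it are therefore absolute products, and these are constructed for all locally blueprinted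
spaces `X` and `Y` in whose stalks the non-units form an ideal, which is stronger than having a
unique maximal ideal.

The points of `X × Y` are the pairs `(x, y)` for which the stalks at `x` and `y` have local
morphisms to a common local blueprint; this is what the existence of a test space through `x` and
`y` requires. The topology is induced by the product topology. A section is a function whose value
at `(x, y)` lies in `LocTensor`, the quotient of the set of products `a ⊗ b` of germs by all
identities that hold in every such local blueprint, and which is locally given by a product of
sections. Since every element of `LocTensor` is a single product `a ⊗ b`, which is a unit as soon as
its image in one of the local blueprints is not in the maximal ideal, no further localization is
needed: the stalks are local and there is just one point over `(x, y)`
(`LocBlprProd.isUnit_of_not_mem`). The universal property (`LocBlprProd.isPullback`) then follows by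
gluing the products of pulled back sections on a test space.

For the dimension, the product of a curve with itself is a subspace of the topological product. An
irreducible closed subset of the latter is the product of the closures of its projections, so
that the dimension is at most `1 + 1`. Conversely, the generic stalk and the stalk at some closed
point `v` have local morphisms to `ℚ`: the former by its values, the latter by sending units to
their signs and non-units to `0`, which respects relations as these are generated by
`1 + (-1) ≡ 0`. Hence the points with coordinates in `{generic, v}` belong to the product, and they
give a chain of length `2`.
-/

/-! ### Sections of a sheaf of blueprints -/

namespace Blpr

theorem coe_comp {A B C : Blpr} (f : A ⟶ B) (g : B ⟶ C) (a : A) : (f ≫ g) a = g (f a) := rfl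

theorem hom_ext {A B : Blpr} {f g : A ⟶ B} (h : ∀ a, f a = g a) : f = g :=
  Hom.ext (MonoidWithZeroHom.ext h)

/-- The free blueprint on one generator: the powers of an indeterminate together with `0`, and no
relations between formal sums other than those that drop zeros. It represents the underlying set of
a blueprint, so that the sheaf condition in the category of blueprints implies that
elements glue. -/
def freeOne : Blpr where
  carrier := WithZero (Multiplicative ℕ)
  pre :=
    { rel := fun s t => s.filter (fun a => a ≠ 0) = t.filter (fun a => a ≠ 0)
      refl := fun _ => rfl
      symm := fun h => h.symm
      trans := fun h h' => h.trans h'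
      add := fun h h' => by rw [Multiset.filter_add, Multiset.filter_add, h, h']
      mul := by
        intro a s t h
        rcases eq_or_ne a 0 with rfl | ha
        · simp [Multiset.filter_map]
        · simp only [Multiset.filter_map, Function.comp_def, ne_eq, mul_eq_zero, ha, false_or]
          exact congrArg _ h
      zero := by simp
      proper := by
        intro a b h
        by_cases ha : a = 0 <;> by_cases hb : b = 0 <;>
          simp_all [Multiset.filter_singleton] }

/-- The generator of the free blueprint. -/
def freeOne.gen : freeOne :=
  ((Multiplicative.ofAdd 1 : Multiplicative ℕ) : WithZero (Multiplicative ℕ))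

/-- The morphism from the free blueprint that takes the generator to a given element. -/
noncomputable def freeOne.lift {B : Blpr} (b : B) : freeOne ⟶ B where
  map := (WithZero.lift' (powersHom B b) : WithZero (Multiplicative ℕ) →*₀ B)
  map_rel := by
    intro (s : Multiset (WithZero (Multiplicative ℕ))) (t : Multiset (WithZero (Multiplicative ℕ)))
      (h : s.filter (fun a => a ≠ 0) = t.filter (fun a => a ≠ 0))
    let f : WithZero (Multiplicative ℕ) →*₀ B := WithZero.lift' (powersHom B b)
    have key : ∀ u : Multiset (WithZero (Multiplicative ℕ)),
        B.rel (u.map f) ((u.filter (fun a => a ≠ 0)).map f) := by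
      intro u
      induction u using Multiset.induction_on with
      | empty => exact B.pre.refl _
      | cons a u ih =>
        by_cases ha : a = 0
        · rw [Multiset.filter_cons_of_neg (p := fun a => a ≠ 0) _ (not_not.2 ha), ha,
            Multiset.map_cons, map_zero, ← zero_add (Multiset.map _ (Multiset.filter _ _)),
            ← Multiset.singleton_add]
          exact B.pre.add B.pre.zero ih
        · rw [Multiset.filter_cons_of_pos (p := fun a => a ≠ 0) _ ha, Multiset.map_cons,
            Multiset.map_cons, ← Multiset.singleton_add,
            ← Multiset.singleton_add _ (Multiset.map _ _)]
          exact B.pre.add (B.pre.refl _) ih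
    have k := key t
    rw [← h] at k
    exact B.pre.trans (key s) (B.pre.symm k)

theorem freeOne.lift_gen {B : Blpr} (b : B) : freeOne.lift b freeOne.gen = b := by
  change WithZero.lift' (powersHom B b) _ = b
  rw [freeOne.gen, WithZero.lift'_coe]
  simp

theorem freeOne.hom_ext {B : Blpr} {f g : freeOne ⟶ B} (h : f gen = g gen) : f = g := by
  refine Hom.ext ?_
  refine (WithZero.lift' (α := Multiplicative ℕ) (β := B)).symm.injective ?_
  refine (powersHom B).symm.injective ?_
  exact h

end Blpr

namespace BlprStalk

variable {X : TopCat.{0}} {F : X.Presheaf Blpr}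

/-- The sheaf condition for a sheaf of blueprints. -/
theorem existsUnique_gluing_hom (hF : F.IsSheaf) (E : Blpr) {V : Opens X} {ι : Type}
    (U : ι → Opens X) (hU : ∀ i, U i ≤ V) (hV : V ≤ iSup U) (sf : ∀ i, E ⟶ F.obj (op (U i)))
    (hsf : ∀ i j e, res F (inf_le_left : U i ⊓ U j ≤ U i) (sf i e) =
      res F (inf_le_right : U i ⊓ U j ≤ U j) (sf j e)) :
    ∃! s : E ⟶ F.obj (op V), ∀ i e, res F (hU i) (s e) = sf i e := by
  obtain rfl : V = iSup U := le_antisymm hV (iSup_le hU)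
  have h := TopCat.Presheaf.IsSheaf.isSheafUniqueGluing_types (U := U)
    (F := F ⋙ coyoneda.obj (op E)) ((isSheaf_iff_isSheaf_of_type _ _).2 (hF E)) sf ?_
  · obtain ⟨s, hs, hs'⟩ := h
    refine ⟨s, fun i e => ?_, fun s' h' => hs' s' fun i => ?_⟩
    · exact congrArg (fun g : E ⟶ F.obj (op (U i)) => g e) (hs i)
    · exact Blpr.hom_ext fun e => h' i e
  · intro i j
    exact Blpr.hom_ext fun e => hsf i j e

theorem eq_of_germ_eq (hF : F.IsSheaf) {V : Opens X} (a b : F.obj (op V))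
    (h : ∀ (x : X) (hx : x ∈ V), germ F x hx a = germ F x hx b) : a = b := by
  have h' : ∀ x : V, ∃ W : Opens X, x.1 ∈ W ∧ ∃ k : W ≤ V, res F k a = res F k b := by
    intro x
    obtain ⟨W, hW, k, k', e⟩ := germ_eq.1 (h x.1 x.2)
    exact ⟨W, hW, k, e⟩
  choose W hW k hk using h'
  have hV : V ≤ iSup W := fun x hx => Opens.mem_iSup.2 ⟨⟨x, hx⟩, hW _⟩
  have hu := existsUnique_gluing_hom hF Blpr.freeOne W k hV
    (fun x => Blpr.freeOne.lift a ≫ F.map (homOfLE (k x)).op) (fun i j e => by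
      simp only [Blpr.coe_comp]
      exact (res_res ..).trans (res_res ..).symm)
  have := hu.unique (y₁ := Blpr.freeOne.lift a) (y₂ := Blpr.freeOne.lift b) (fun _ _ => rfl) (by
    intro x
    refine fun e => congrArg (fun g : Blpr.freeOne ⟶ F.obj (op (W x)) => g e)
      (?_ : Blpr.freeOne.lift b ≫ F.map (homOfLE (k x)).op = _)
    refine Blpr.freeOne.hom_ext ?_
    rw [Blpr.coe_comp, Blpr.coe_comp, Blpr.freeOne.lift_gen, Blpr.freeOne.lift_gen]
    exact (hk x).symm)
  rw [← Blpr.freeOne.lift_gen a, ← Blpr.freeOne.lift_gen b, this]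

/-- A family of germs that is locally given by sections is given by a section. -/
theorem exists_section_of_germs (hF : F.IsSheaf) {V : Opens X} (τ : ∀ x : X, x ∈ V → Germ F x)
    (h : ∀ (x : X) (_ : x ∈ V), ∃ (W : Opens X) (_ : x ∈ W) (k : W ≤ V) (a : F.obj (op W)),
      ∀ (y : X) (hy : y ∈ W), germ F y hy a = τ y (k hy)) :
    ∃ a : F.obj (op V), ∀ (x : X) (hx : x ∈ V), germ F x hx a = τ x hx := by
  choose W hW k a ha using fun x : V => h x.1 x.2
  have hV : V ≤ iSup W := fun x hx => Opens.mem_iSup.2 ⟨⟨x, hx⟩, hW _⟩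
  obtain ⟨s, hs, -⟩ := existsUnique_gluing_hom hF Blpr.freeOne W k hV
    (fun x => Blpr.freeOne.lift (a x)) (fun i j e => by
      refine congrArg (fun g : Blpr.freeOne ⟶ F.obj (op (W i ⊓ W j)) => g e)
        (?_ : Blpr.freeOne.lift (a i) ≫ F.map (homOfLE inf_le_left).op =
          Blpr.freeOne.lift (a j) ≫ F.map (homOfLE inf_le_right).op)
      refine Blpr.freeOne.hom_ext ?_
      rw [Blpr.coe_comp, Blpr.coe_comp, Blpr.freeOne.lift_gen, Blpr.freeOne.lift_gen]
      refine eq_of_germ_eq hF _ _ fun x hx => ?_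
      exact (germ_res hx.1 hx _ _).trans ((ha i x hx.1).trans
        ((ha j x hx.2).symm.trans (germ_res hx.2 hx _ _).symm)))
  refine ⟨s Blpr.freeOne.gen, fun x hx => ?_⟩
  have e := hs ⟨x, hx⟩ Blpr.freeOne.gen
  rw [Blpr.freeOne.lift_gen] at e
  rw [← germ_res hx (hW ⟨x, hx⟩) (k ⟨x, hx⟩), e, ha]

/-- The germ at a point, as a morphism of blueprints. -/
def germHom (F : X.Presheaf Blpr) (x : X) {U : Opens X} (hU : x ∈ U) :
    Blpr.Hom (F.obj (op U)) (stalk F x) where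
  map :=
    { toFun := germ F x hU
      map_zero' := germ_zero hU
      map_one' := germ_one hU
      map_mul' := germ_mul' hU }
  map_rel := fun {s t} h => ⟨U, hU, s, t, h, rfl, rfl⟩

theorem stalk_surj {x : X} (g : stalk F x) : ∃ (U : Opens X) (h : x ∈ U) (a : F.obj (op U)),
    germHom F x h a = g := germ_surj g

theorem germHom_res {x : X} {U V : Opens X} (hU : x ∈ U) (hV : x ∈ V) (h : V ≤ U)
    (a : F.obj (op U)) : germHom F x hV (res F h a) = germHom F x hU a := germ_res hU hV h a

/-- Relations between formal sums of sections can be checked on germs. The proof applies the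
sheaf condition to the sections over `V` with the pre-addition of local relations. -/
theorem rel_of_germ_rel (hF : F.IsSheaf) {V : Opens X} (s t : Multiset (F.obj (op V)))
    (h : ∀ (x : X) (hx : x ∈ V),
      (stalk F x).rel (s.map (germHom F x hx)) (t.map (germHom F x hx))) :
    (F.obj (op V)).rel s t := by
  have h' : ∀ x : V, ∃ W : Opens X, x.1 ∈ W ∧ ∃ k : W ≤ V,
      (F.obj (op W)).rel (s.map (res F k)) (t.map (res F k)) := by
    intro x
    obtain ⟨U, hU, s', t', hr, hs, ht⟩ := h x.1 x.2
    have aux : ∀ (u : Multiset (F.obj (op V))) (u' : Multiset (F.obj (op U))),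
        u'.map (germ F x.1 hU) = u.map (germHom F x.1 x.2) →
        ∃ W : Opens X, x.1 ∈ W ∧ ∃ (k : W ≤ V) (k' : W ≤ U),
          u'.map (res F k') = u.map (res F k) := by
      intro u u' e
      have e' : (u'.map (res F inf_le_right)).map (germ F x.1 (U := V ⊓ U) (mem_inf x.2 hU)) =
          (u.map (res F inf_le_left)).map (germ F x.1 (U := V ⊓ U) (mem_inf x.2 hU)) := by
        rw [map_germ_res hU, map_germ_res x.2]
        exact e
      obtain ⟨W, hW, l, e''⟩ := exists_res_eq _ _ _ e'
      refine ⟨W, hW, l.trans inf_le_left, l.trans inf_le_right, ?_⟩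
      simpa only [Multiset.map_map, Function.comp_def, res_res] using e''
    obtain ⟨W, hW, k, k', e⟩ := aux s s' hs
    obtain ⟨Z, hZ, l, l', e'⟩ := aux t t' ht
    refine ⟨W ⊓ Z, ⟨hW, hZ⟩, inf_le_left.trans k, ?_⟩
    have e1 := congrArg (Multiset.map (res F (inf_le_left : W ⊓ Z ≤ W))) e
    have e2 := congrArg (Multiset.map (res F (inf_le_right : W ⊓ Z ≤ Z))) e'
    simp only [Multiset.map_map, Function.comp_def, res_res] at e1 e2
    rw [← e1, ← e2]
    exact res_rel F _ hr
  choose W hW k hk using h'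
  have hV : V ≤ iSup W := fun x hx => Opens.mem_iSup.2 ⟨⟨x, hx⟩, hW _⟩
  let E : Blpr :=
    { carrier := F.obj (op V)
      pre := PreAddition.induced (fun x : V => (F.obj (op (W x))).pre)
        (fun x => (F.map (homOfLE (k x)).op).map) (by
          intro a b hab
          refine eq_of_germ_eq hF a b fun x hx => ?_
          rw [← germ_res hx (hW ⟨x, hx⟩) (k ⟨x, hx⟩), ← germ_res hx (hW ⟨x, hx⟩) (k ⟨x, hx⟩) b]
          exact congrArg _ (hab ⟨x, hx⟩)) }
  -- The restrictions are morphisms from `E`; they glue to a morphism that is the identity on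
  -- elements, so that local relations are relations over `V`.
  obtain ⟨f, hf, -⟩ := existsUnique_gluing_hom hF E W k hV
    (fun x => { map := (F.map (homOfLE (k x)).op).map, map_rel := fun h => h x })
    (fun i j e => (res_res ..).trans (res_res ..).symm)
  have hfid : ∀ a : F.obj (op V), f.map a = a := by
    intro a
    refine eq_of_germ_eq hF _ _ fun x hx => ?_
    rw [← germ_res hx (hW ⟨x, hx⟩) (k ⟨x, hx⟩), ← germ_res hx (hW ⟨x, hx⟩) (k ⟨x, hx⟩) a]
    exact congrArg _ (hf ⟨x, hx⟩ a)
  have hr : (F.obj (op V)).rel (s.map f.map) (t.map f.map) := f.map_rel (s := s) (t := t) hk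
  have hid : ∀ u : Multiset (F.obj (op V)), u.map f.map = u := fun u =>
    (Multiset.map_congr rfl fun a _ => hfid a).trans (Multiset.map_id' u)
  rw [← hid s, ← hid t]
  exact hr

end BlprStalk

/-! ### Blueprints whose non-units form an ideal -/

namespace Blpr

/-- The non-units form an ideal. Such a blueprint is local, but a local blueprint can have
non-units outside of its maximal ideal. -/
def HasNonunitIdeal (B : Blpr) : Prop := ∃ I : BIdeal B, ∀ a, a ∈ I.carrier ↔ ¬ IsUnit a

theorem HasNonunitIdeal.isLocal {B : Blpr} (h : B.HasNonunitIdeal) : B.IsLocal :=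
  h.elim fun I hI => isLocal_of_nonunits I hI

theorem BIdeal.IsMaximal.not_mem_of_isUnit {B : Blpr} {I : BIdeal B} (h : I.IsMaximal) {a : B}
    (ha : IsUnit a) : a ∉ I.carrier := by
  obtain ⟨u, rfl⟩ := ha
  refine fun hu => h.1 (Set.eq_univ_of_forall fun b => ?_)
  simpa using I.mul_mem (b * ↑u⁻¹) _ hu

theorem HasNonunitIdeal.mem_iff {B : Blpr} (h : B.HasNonunitIdeal) {I : BIdeal B}
    (hI : I.IsMaximal) (a : B) : a ∈ I.carrier ↔ ¬ IsUnit a := by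
  refine ⟨fun ha hu => hI.not_mem_of_isUnit hu ha, fun ha => ?_⟩
  obtain ⟨J, hJ⟩ := h
  have hJu : J.carrier ≠ Set.univ := fun e => (hJ 1).1 (e ▸ Set.mem_univ (1 : B)) isUnit_one
  have := hI.2 J (fun b hb => (hJ b).2 fun hu => hI.not_mem_of_isUnit hu hb) hJu
  rw [← this]
  exact (hJ a).2 ha

theorem Hom.isUnit {B C : Blpr} (f : Hom B C) {a : B} (ha : IsUnit a) : IsUnit (f a) :=
  ha.map f.map

/-- If the elements mapped outside of the maximal ideal of a local blueprint are units, then the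
non-units are the preimage of that maximal ideal, hence an ideal. -/
theorem hasNonunitIdeal_of_hom {B D : Blpr} (f : Hom B D) {J : BIdeal D} (hJ : J.IsMaximal)
    (h : ∀ a, f a ∉ J.carrier → IsUnit a) : B.HasNonunitIdeal := by
  have key : ∀ a, f a ∈ J.carrier ↔ ¬ IsUnit a := fun a =>
    ⟨fun ha hu => hJ.not_mem_of_isUnit (f.isUnit hu) ha, fun ha => by_contra fun h' => ha (h a h')⟩
  refine ⟨{ carrier := {a | f a ∈ J.carrier}, zero_mem := ?_, mul_mem := ?_, rel_mem := ?_ }, key⟩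
  · have : f 0 = 0 := map_zero f.map
    rw [Set.mem_ofPred_eq, this]
    exact J.zero_mem
  · intro a b hb
    have : f (a * b) = f a * f b := map_mul f.map a b
    rw [Set.mem_ofPred_eq, this]
    exact J.mul_mem _ _ hb
  · intro c s t hs ht hr
    refine J.rel_mem (f c) (s.map f) (t.map f) ?_ ?_ ?_
    · intro a ha
      obtain ⟨b, hb, rfl⟩ := Multiset.mem_map.1 ha
      exact hs b hb
    · intro a ha
      obtain ⟨b, hb, rfl⟩ := Multiset.mem_map.1 ha
      exact ht b hb
    · rw [← Multiset.map_cons]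
      exact f.map_rel hr

end Blpr

/-! ### The universal target of local morphisms from two blueprints -/

/-- A local blueprint with local morphisms from `A` and from `B`. -/
structure LocalCocone (A B : Blpr) where
  pt : Blpr
  isLocal : pt.IsLocal
  inl : Blpr.Hom A pt
  inr : Blpr.Hom B pt
  isLocal_inl : Blpr.IsLocalMap inl
  isLocal_inr : Blpr.IsLocalMap inr

namespace LocTensor

variable (A B : Blpr)

/-- Pairs `(a, b)`, standing for products `a ⊗ b`, are identified if they have the same product in
all local blueprints with local morphisms from `A` and `B`. -/
def setoid : Setoid (A.carrier × B.carrier) where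
  r u v := ∀ c : LocalCocone A B, c.inl u.1 * c.inr u.2 = c.inl v.1 * c.inr v.2
  iseqv := ⟨fun _ _ => rfl, fun h c => (h c).symm, fun h h' c => (h c).trans (h' c)⟩

/-- The products `a ⊗ b` of elements of `A` and `B`. -/
def Carrier : Type := Quotient (setoid A B)

variable {A B}

/-- The product `a ⊗ b`. -/
def tmul (a : A) (b : B) : Carrier A B := Quotient.mk (setoid A B) (a, b)

theorem tmul_eq {a a' : A} {b b' : B} : tmul a b = tmul a' b' ↔
    ∀ c : LocalCocone A B, c.inl a * c.inr b = c.inl a' * c.inr b' :=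
  Quotient.eq (r := setoid A B)

theorem tmul_surj (g : Carrier A B) : ∃ a b, tmul a b = g := by
  induction g using Quotient.inductionOn with
  | h p => exact ⟨p.1, p.2, rfl⟩

instance : Mul (Carrier A B) where
  mul g g' := Quotient.liftOn₂ g g' (fun u v => tmul (u.1 * v.1) (u.2 * v.2)) (by
    intro u v u' v' h h'
    refine tmul_eq.2 fun c => ?_
    have e1 : ∀ a b, c.inl (a * b) = c.inl a * c.inl b := fun a b => map_mul c.inl.map a b
    have e2 : ∀ a b, c.inr (a * b) = c.inr a * c.inr b := fun a b => map_mul c.inr.map a b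
    rw [e1, e1, e2, e2, mul_mul_mul_comm, mul_mul_mul_comm (c.inl u'.1)]
    exact congrArg₂ _ (h c) (h' c))

theorem tmul_mul_tmul (a a' : A) (b b' : B) :
    tmul a b * tmul a' b' = tmul (a * a') (b * b') := rfl

instance : CommMonoidWithZero (Carrier A B) where
  one := tmul 1 1
  zero := tmul 0 0
  mul_assoc := by
    intro x y z
    obtain ⟨a, b, rfl⟩ := tmul_surj x
    obtain ⟨a', b', rfl⟩ := tmul_surj y
    obtain ⟨a'', b'', rfl⟩ := tmul_surj z
    simp only [tmul_mul_tmul, mul_assoc]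
  mul_comm := by
    intro x y
    obtain ⟨a, b, rfl⟩ := tmul_surj x
    obtain ⟨a', b', rfl⟩ := tmul_surj y
    rw [tmul_mul_tmul, tmul_mul_tmul, mul_comm a, mul_comm b]
  one_mul := by
    intro x
    obtain ⟨a, b, rfl⟩ := tmul_surj x
    exact (tmul_mul_tmul _ _ _ _).trans (by rw [one_mul, one_mul])
  mul_one := by
    intro x
    obtain ⟨a, b, rfl⟩ := tmul_surj x
    exact (tmul_mul_tmul _ _ _ _).trans (by rw [mul_one, mul_one])
  zero_mul := by
    intro x
    obtain ⟨a, b, rfl⟩ := tmul_surj x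
    exact (tmul_mul_tmul _ _ _ _).trans (by rw [zero_mul, zero_mul]; rfl)
  mul_zero := by
    intro x
    obtain ⟨a, b, rfl⟩ := tmul_surj x
    exact (tmul_mul_tmul _ _ _ _).trans (by rw [mul_zero, mul_zero]; rfl)

theorem tmul_one_one : (tmul 1 1 : Carrier A B) = 1 := rfl

theorem tmul_zero_zero : (tmul 0 0 : Carrier A B) = 0 := rfl

/-- The multiplicative map to a local blueprint with local morphisms from `A` and `B`. -/
def desc (c : LocalCocone A B) : Carrier A B →*₀ c.pt where
  toFun := Quotient.lift (fun u => c.inl u.1 * c.inr u.2) fun _ _ h => h c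
  map_zero' := by
    change c.inl 0 * c.inr 0 = 0
    have : c.inl 0 = 0 := map_zero c.inl.map
    rw [this, zero_mul]
  map_one' := by
    change c.inl 1 * c.inr 1 = 1
    have h1 : c.inl 1 = 1 := map_one c.inl.map
    have h2 : c.inr 1 = 1 := map_one c.inr.map
    rw [h1, h2, one_mul]
  map_mul' x y := by
    obtain ⟨a, b, rfl⟩ := tmul_surj x
    obtain ⟨a', b', rfl⟩ := tmul_surj y
    change c.inl (a * a') * c.inr (b * b') = c.inl a * c.inr b * (c.inl a' * c.inr b')
    have h1 : c.inl (a * a') = c.inl a * c.inl a' := map_mul c.inl.map _ _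
    have h2 : c.inr (b * b') = c.inr b * c.inr b' := map_mul c.inr.map _ _
    rw [h1, h2, mul_mul_mul_comm]

theorem desc_tmul (c : LocalCocone A B) (a : A) (b : B) :
    desc c (tmul a b) = c.inl a * c.inr b := rfl

/-- Formal sums are related if their images are related in all local blueprints with local
morphisms from `A` and `B`. -/
def pre : PreAddition (Carrier A B) where
  rel s t := ∀ c : LocalCocone A B, c.pt.rel (s.map (desc c)) (t.map (desc c))
  refl _ c := c.pt.pre.refl _
  symm h c := c.pt.pre.symm (h c)
  trans h h' c := c.pt.pre.trans (h c) (h' c)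
  add h h' c := by
    rw [Multiset.map_add, Multiset.map_add]
    exact c.pt.pre.add (h c) (h' c)
  mul a s t h c := by
    have : c.pt.rel _ _ := c.pt.pre.mul (desc c a) (h c)
    simpa [Multiset.map_map, Function.comp_def] using this
  zero c := by
    have : c.pt.rel {0} 0 := c.pt.pre.zero
    simpa using this
  proper {x y} h := by
    obtain ⟨a, b, rfl⟩ := tmul_surj x
    obtain ⟨a', b', rfl⟩ := tmul_surj y
    exact tmul_eq.2 fun c => c.pt.pre.proper (by simpa using! h c)

end LocTensor

/-- The blueprint of products `a ⊗ b` with those identities and relations that hold in all local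
blueprints with local morphisms from `A` and `B`. -/
def LocTensor (A B : Blpr) : Blpr where
  carrier := LocTensor.Carrier A B
  pre := LocTensor.pre

namespace LocTensor

variable {A B : Blpr}

/-- The universal property of `LocTensor A B`. -/
def descHom (c : LocalCocone A B) : Blpr.Hom (LocTensor A B) c.pt where
  map := desc c
  map_rel h := h c

/-- The morphism `a ↦ a ⊗ 1`. -/
def inl : Blpr.Hom A (LocTensor A B) where
  map :=
    { toFun := fun a => tmul a 1
      map_zero' := tmul_eq.2 fun c => by
        have : c.inl 0 = 0 := map_zero c.inl.map
        rw [this, zero_mul, zero_mul]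
      map_one' := rfl
      map_mul' := fun a a' => by
        refine Eq.trans ?_ (tmul_mul_tmul a a' (1 : B) 1).symm
        rw [one_mul] }
  map_rel := by
    intro s t h c
    have e : ∀ a : A, desc c (tmul a 1) = c.inl a := fun a => by
      have : c.inr 1 = 1 := map_one c.inr.map
      rw [desc_tmul, this, mul_one]
    have e' : ∀ u : Multiset A, (u.map fun a => (tmul a 1 : Carrier A B)).map (desc c) =
      u.map c.inl := multiset_map_map_of _ _ _ e
    exact (congrArg₂ c.pt.rel (e' s) (e' t)).mpr (c.inl.map_rel h)

/-- The morphism `b ↦ 1 ⊗ b`. -/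
def inr : Blpr.Hom B (LocTensor A B) where
  map :=
    { toFun := fun b => tmul 1 b
      map_zero' := tmul_eq.2 fun c => by
        have : c.inr 0 = 0 := map_zero c.inr.map
        rw [this, mul_zero, mul_zero]
      map_one' := rfl
      map_mul' := fun b b' => by
        refine Eq.trans ?_ (tmul_mul_tmul (1 : A) 1 b b').symm
        rw [one_mul] }
  map_rel := by
    intro s t h c
    have e : ∀ b : B, desc c (tmul 1 b) = c.inr b := fun b => by
      have : c.inl 1 = 1 := map_one c.inl.map
      rw [desc_tmul, this, one_mul]
    have e' : ∀ u : Multiset B, (u.map fun b => (tmul 1 b : Carrier A B)).map (desc c) =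
      u.map c.inr := multiset_map_map_of _ _ _ e
    exact (congrArg₂ c.pt.rel (e' s) (e' t)).mpr (c.inr.map_rel h)

theorem inl_mul_inr (a : A) (b : B) : (inl a * inr b : LocTensor A B) = tmul a b := by
  refine (tmul_mul_tmul a 1 1 b).trans ?_
  rw [one_mul, mul_one]

theorem descHom_inl (c : LocalCocone A B) (a : A) : descHom c (inl a) = c.inl a := by
  refine (desc_tmul c a 1).trans ?_
  have : c.inr 1 = 1 := map_one c.inr.map
  rw [this, mul_one]

theorem descHom_inr (c : LocalCocone A B) (b : B) : descHom c (inr b) = c.inr b := by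
  refine (desc_tmul c 1 b).trans ?_
  have : c.inl 1 = 1 := map_one c.inl.map
  rw [this, one_mul]

end LocTensor

/-! ### Sheaves of functions with values in blueprints -/

/-- A local condition on functions `w ↦ f w ∈ B w` that is satisfied by `0` and `1` and stable under
products. -/
structure BlprLocalPredicate {P : TopCat.{0}} (B : P → Blpr) where
  pred : ∀ W : Opens P, (∀ w : W, B w.1) → Prop
  zero : ∀ W, pred W fun _ => 0
  one : ∀ W, pred W fun _ => 1
  mul : ∀ {W f g}, pred W f → pred W g → pred W fun w => f w * g w
  res : ∀ {V W : Opens P} (h : V ≤ W) {f}, pred W f → pred V fun w => f ⟨w.1, h w.2⟩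
  locality : ∀ {W : Opens P} (f : ∀ w : W, B w.1), (∀ w : W, ∃ (V : Opens P) (h : V ≤ W),
    w.1 ∈ V ∧ pred V fun v => f ⟨v.1, h v.2⟩) → pred W f

namespace BlprLocalPredicate

variable {P : TopCat.{0}} {B : P → Blpr} (L : BlprLocalPredicate B)

/-- The functions over `W` that satisfy the condition. -/
def Sec (W : Opens P) : Type := {f : ∀ w : W, B w.1 // L.pred W f}

namespace Sec

variable {L} {W V : Opens P}

theorem ext {f g : L.Sec W} (h : ∀ w, f.1 w = g.1 w) : f = g := Subtype.ext (funext h)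

instance : Zero (L.Sec W) := ⟨fun _ => 0, L.zero W⟩

instance : One (L.Sec W) := ⟨fun _ => 1, L.one W⟩

instance : Mul (L.Sec W) := ⟨fun f g => ⟨fun w => f.1 w * g.1 w, L.mul f.2 g.2⟩⟩

instance : CommMonoidWithZero (L.Sec W) where
  mul_assoc a b c := ext fun _ => mul_assoc _ _ _
  mul_comm a b := ext fun _ => mul_comm _ _
  one_mul a := ext fun _ => one_mul _
  mul_one a := ext fun _ => mul_one _
  zero_mul a := ext fun _ => zero_mul _
  mul_zero a := ext fun _ => mul_zero _

/-- The value of a function at a point. -/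
def eval (w : W) : L.Sec W →*₀ B w.1 where
  toFun f := f.1 w
  map_zero' := rfl
  map_one' := rfl
  map_mul' _ _ := rfl

/-- Restriction of functions. -/
def restrict (h : V ≤ W) : L.Sec W →*₀ L.Sec V where
  toFun f := ⟨fun w => f.1 ⟨w.1, h w.2⟩, L.res h f.2⟩
  map_zero' := rfl
  map_one' := rfl
  map_mul' _ _ := rfl

end Sec

/-- The blueprint of functions over `W`, with pointwise relations. -/
def secBlpr (W : Opens P) : Blpr where
  carrier := L.Sec W
  pre := PreAddition.induced (fun w : W => (B w.1).pre) Sec.eval fun _ _ h => Sec.ext h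

/-- The presheaf of functions. -/
def presheaf : P.Presheaf Blpr where
  obj U := L.secBlpr U.unop
  map {U V} i :=
    { map := Sec.restrict i.unop.le
      map_rel := by
        intro s t h x
        have e := multiset_map_map_of (Sec.restrict (L := L) i.unop.le) (Sec.eval x)
          (Sec.eval ⟨x.1, i.unop.le x.2⟩) fun _ => rfl
        exact (congrArg₂ (B x.1).rel (e s) (e t)).mpr (h ⟨x.1, i.unop.le x.2⟩) }

theorem isSheaf : L.presheaf.IsSheaf := by
  intro E
  rw [← isSheaf_iff_isSheaf_of_type]
  refine TopCat.Presheaf.isSheaf_of_isSheafUniqueGluing_types (X := P)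
    (L.presheaf ⋙ coyoneda.obj (op E)) ?_
  intro ι U sf hc
  have hval : ∀ (i j : ι) (x : P) (hi : x ∈ U i) (hj : x ∈ U j) (e : E),
      ((sf i).map e).1 ⟨x, hi⟩ = ((sf j).map e).1 ⟨x, hj⟩ := by
    intro i j x hi hj e
    have h1 : (sf i ≫ L.presheaf.map (Opens.infLELeft (U i) (U j)).op : E ⟶ _) =
        sf j ≫ L.presheaf.map (Opens.infLERight (U i) (U j)).op := hc i j
    exact congrArg (fun g : E ⟶ L.secBlpr (U i ⊓ U j) => (g.map e).1 ⟨x, hi, hj⟩) h1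
  let W : Opens P := iSup U
  have hex : ∀ x : W, ∃ i, x.1 ∈ U i := fun x => Opens.mem_iSup.1 x.2
  choose k hk using hex
  let v : E → ∀ w : W, B w.1 := fun e x => ((sf (k x)).map e).1 ⟨x.1, hk x⟩
  have hv : ∀ (e : E) (i : ι) (x : P) (hi : x ∈ U i) (hx : x ∈ W),
      v e ⟨x, hx⟩ = ((sf i).map e).1 ⟨x, hi⟩ := fun e i x hi hx => hval _ _ _ _ _ _
  have hmem : ∀ e, L.pred W (v e) := by
    intro e
    refine L.locality _ fun w => ⟨U (k w), le_iSup U _, hk w, ?_⟩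
    have h := ((sf (k w)).map e).2
    convert! h using 2 with x
    exact hv e (k w) x.1 x.2 _
  let w : E ⟶ L.secBlpr (iSup U) :=
    { map :=
        { toFun := fun e => ⟨v e, hmem e⟩
          map_zero' := Sec.ext fun x =>
            congrArg (fun g : L.Sec (U (k x)) => g.1 ⟨x.1, hk x⟩) (map_zero (sf (k x)).map)
          map_one' := Sec.ext fun x =>
            congrArg (fun g : L.Sec (U (k x)) => g.1 ⟨x.1, hk x⟩) (map_one (sf (k x)).map)
          map_mul' := fun a b => Sec.ext fun x =>
            congrArg (fun g : L.Sec (U (k x)) => g.1 ⟨x.1, hk x⟩) (map_mul (sf (k x)).map a b) }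
      map_rel := by
        intro s t h x
        have := (sf (k x)).map_rel h ⟨x.1, hk x⟩
        have e := multiset_map_map_of (sf (k x)).map (Sec.eval (L := L) ⟨x.1, hk x⟩)
          (fun a => v a x) fun _ => rfl
        have e' := multiset_map_map_of (fun a => (⟨v a, hmem a⟩ : L.Sec W)) (Sec.eval (L := L) x)
          (fun a => v a x) fun _ => rfl
        exact (congrArg₂ (B x.1).rel ((e' s).trans (e s).symm)
          ((e' t).trans (e t).symm)).mpr this }
  refine ⟨w, ?_, ?_⟩
  · intro i
    exact Blpr.hom_ext fun e => Sec.ext fun x => hv e i x.1 x.2 (Opens.mem_iSup.2 ⟨i, x.2⟩)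
  · intro w' hw'
    refine Blpr.hom_ext fun e => Sec.ext fun x => ?_
    have h1 : (w' ≫ L.presheaf.map (Opens.leSupr U (k x)).op : E ⟶ _) = sf (k x) := hw' (k x)
    exact congrArg (fun g : E ⟶ L.secBlpr (U (k x)) => (g.map e).1 ⟨x.1, hk x⟩) h1

open BlprStalk in
/-- The value of a germ of functions at the point. -/
def evalStalk (w : P) : Blpr.Hom (stalk L.presheaf w) (B w) where
  map :=
    { toFun := Quotient.lift (fun p => (p.val : L.Sec p.U).1 ⟨w, p.mem⟩) (by
        rintro ⟨U, hU, a⟩ ⟨V, hV, b⟩ ⟨W, hW, h, h', e⟩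
        exact congrArg (fun g : L.Sec W => g.1 ⟨w, hW⟩) e)
      map_zero' := rfl
      map_one' := rfl
      map_mul' := by
        intro g g'
        obtain ⟨U, hU, a, b, rfl, rfl⟩ := germ_surj₂ g g'
        rfl }
  map_rel := by
    rintro _ _ ⟨U, hU, s, t, h, rfl, rfl⟩
    have e := multiset_map_map_of (germ L.presheaf w hU)
      (Quotient.lift (fun p => (p.val : L.Sec p.U).1 ⟨w, p.mem⟩) (by
        rintro ⟨U, hU, a⟩ ⟨V, hV, b⟩ ⟨W, hW, h, h', e⟩
        exact congrArg (fun g : L.Sec W => g.1 ⟨w, hW⟩) e))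
      (Sec.eval (L := L) ⟨w, hU⟩) fun _ => rfl
    exact (congrArg₂ (B w).rel (e s) (e t)).mpr (h ⟨w, hU⟩)

end BlprLocalPredicate

/-! ### Morphisms of locally blueprinted spaces -/

namespace LocBlprSp

/-- The stalk of the structure sheaf. -/
abbrev stalk (X : LocBlprSp) (x : X.carrier) : Blpr := BlprStalk.stalk X.presheaf x

/-- A morphism is determined by its map of points and by its maps of germs. -/
theorem hom_ext {X Y : LocBlprSp} {f g : X ⟶ Y} (h : ∀ x, f.base x = g.base x)
    (h' : ∀ (x : X.carrier) (U : Opens Y.carrier) (hf : f.base x ∈ U) (hg : g.base x ∈ U)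
      (a : Y.presheaf.obj (op U)),
      BlprStalk.germHom X.presheaf x (U := (Opens.map f.base).obj U) hf (f.c.app (op U) a) =
      BlprStalk.germHom X.presheaf x (U := (Opens.map g.base).obj U) hg (g.c.app (op U) a)) :
    f = g := by
  obtain ⟨⟨fb, fc⟩, hf⟩ := f
  obtain ⟨⟨gb, gc⟩, hg⟩ := g
  have hb : fb = gb := by
    ext x
    exact h x
  subst hb
  have hc : fc = gc := by
    refine NatTrans.ext (funext fun U => Blpr.hom_ext fun a => ?_)
    exact BlprStalk.eq_of_germ_eq X.IsSheaf _ _ fun x hx => h' x U.unop hx hx a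
  subst hc
  rfl

end LocBlprSp

/-! ### Products of locally blueprinted spaces -/

namespace LocBlprProd

open BlprStalk BlprSp

variable (X Y : LocBlprSp)

/-- The points of the product: pairs of points whose stalks have local morphisms to a common local
blueprint. The topology is induced by the product topology. -/
abbrev Pt : TopCat.{0} :=
  TopCat.of {z : X.carrier × Y.carrier // Nonempty (LocalCocone (X.stalk z.1) (Y.stalk z.2))}

/-- The first projection on points. -/
def fstBase : Pt X Y ⟶ X.carrier :=
  TopCat.ofHom ⟨fun w => w.1.1, continuous_fst.comp continuous_subtype_val⟩

/-- The second projection on points. -/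
def sndBase : Pt X Y ⟶ Y.carrier :=
  TopCat.ofHom ⟨fun w => w.1.2, continuous_snd.comp continuous_subtype_val⟩

/-- The functions that are locally of the form `a ⊗ b` with sections `a` of `X` and `b` of `Y`. -/
def localPredicate :
    BlprLocalPredicate fun w : Pt X Y => LocTensor (X.stalk w.1.1) (Y.stalk w.1.2) where
  pred W f := ∀ w : W, ∃ (N : Opens (Pt X Y)) (hN : N ≤ W) (U : Opens X.carrier)
    (V : Opens Y.carrier) (hU : ∀ n ∈ N, n.1.1 ∈ U) (hV : ∀ n ∈ N, n.1.2 ∈ V)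
    (a : X.presheaf.obj (op U)) (b : Y.presheaf.obj (op V)), w.1 ∈ N ∧
    ∀ (n : Pt X Y) (hn : n ∈ N), f ⟨n, hN hn⟩ =
      LocTensor.tmul (germHom X.presheaf n.1.1 (hU n hn) a) (germHom Y.presheaf n.1.2 (hV n hn) b)
  zero W w := ⟨W, le_rfl, ⊤, ⊤, fun _ _ => trivial, fun _ _ => trivial, 0, 0, w.2, fun n _ => by
    refine LocTensor.tmul_zero_zero.symm.trans (congrArg₂ LocTensor.tmul ?_ ?_)
    · exact (map_zero (germHom X.presheaf n.1.1 _).map).symm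
    · exact (map_zero (germHom Y.presheaf n.1.2 _).map).symm⟩
  one W w := ⟨W, le_rfl, ⊤, ⊤, fun _ _ => trivial, fun _ _ => trivial, 1, 1, w.2, fun n _ => by
    refine LocTensor.tmul_one_one.symm.trans (congrArg₂ LocTensor.tmul ?_ ?_)
    · exact (map_one (germHom X.presheaf n.1.1 _).map).symm
    · exact (map_one (germHom Y.presheaf n.1.2 _).map).symm⟩
  mul := by
    intro W f g hf hg w
    obtain ⟨N, hN, U, V, hU, hV, a, b, hw, e⟩ := hf w
    obtain ⟨N', hN', U', V', hU', hV', a', b', hw', e'⟩ := hg w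
    refine ⟨N ⊓ N', inf_le_left.trans hN, U ⊓ U', V ⊓ V', fun n hn => ⟨hU n hn.1, hU' n hn.2⟩,
      fun n hn => ⟨hV n hn.1, hV' n hn.2⟩,
      res X.presheaf inf_le_left a * res X.presheaf inf_le_right a',
      res Y.presheaf inf_le_left b * res Y.presheaf inf_le_right b', ⟨hw, hw'⟩, fun n hn => ?_⟩
    refine (congrArg₂ _ (e n hn.1) (e' n hn.2)).trans ?_
    refine (LocTensor.tmul_mul_tmul _ _ _ _).trans (congrArg₂ LocTensor.tmul ?_ ?_)
    · refine Eq.trans ?_ (map_mul (germHom X.presheaf n.1.1 _).map _ _).symm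
      exact congrArg₂ _ (germHom_res (hU n hn.1) _ _ _).symm (germHom_res (hU' n hn.2) _ _ _).symm
    · refine Eq.trans ?_ (map_mul (germHom Y.presheaf n.1.2 _).map _ _).symm
      exact congrArg₂ _ (germHom_res (hV n hn.1) _ _ _).symm (germHom_res (hV' n hn.2) _ _ _).symm
  res := by
    intro W' W h f hf w
    obtain ⟨N, hN, U, V, hU, hV, a, b, hw, e⟩ := hf ⟨w.1, h w.2⟩
    exact ⟨N ⊓ W', inf_le_right, U, V, fun n hn => hU n hn.1, fun n hn => hV n hn.1, a, b,
      ⟨hw, w.2⟩, fun n hn => e n hn.1⟩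
  locality := by
    intro W f hf w
    obtain ⟨W', h, hw, hf'⟩ := hf w
    obtain ⟨N, hN, U, V, hU, hV, a, b, hw, e⟩ := hf' ⟨w.1, hw⟩
    exact ⟨N, hN.trans h, U, V, hU, hV, a, b, hw, e⟩

/-- The product as a presheafed space. -/
def presheafedSpace : PresheafedSpace.{0, 1, 0} Blpr where
  carrier := Pt X Y
  presheaf := (localPredicate X Y).presheaf

/-- The first projection. -/
def fst : (presheafedSpace X Y).Hom X.toPresheafedSpace where
  base := fstBase X Y
  c :=
    { app := fun U =>
        { map :=
            { toFun := fun a => ⟨fun w => LocTensor.inl (germHom X.presheaf w.1.1.1 w.2 a),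
                fun w => ⟨(Opens.map (fstBase X Y)).obj U.unop, le_rfl, U.unop, ⊤, fun _ h => h,
                  fun _ _ => trivial, a, 1, w.2, fun n hn => by
                    refine congrArg (LocTensor.tmul _) ?_
                    exact (map_one (germHom Y.presheaf n.1.2 _).map).symm⟩⟩
              map_zero' := BlprLocalPredicate.Sec.ext (L := localPredicate X Y)
                fun w : (Opens.map (fstBase X Y)).obj U.unop =>
                (congrArg LocTensor.inl (map_zero (germHom X.presheaf w.1.1.1 w.2).map)).trans
                  (map_zero LocTensor.inl.map)
              map_one' := BlprLocalPredicate.Sec.ext (L := localPredicate X Y)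
                fun w : (Opens.map (fstBase X Y)).obj U.unop =>
                (congrArg LocTensor.inl (map_one (germHom X.presheaf w.1.1.1 w.2).map)).trans
                  (map_one LocTensor.inl.map)
              map_mul' := fun a b => BlprLocalPredicate.Sec.ext (L := localPredicate X Y)
                fun w : (Opens.map (fstBase X Y)).obj U.unop =>
                (congrArg LocTensor.inl (map_mul (germHom X.presheaf w.1.1.1 w.2).map a b)).trans
                  (map_mul LocTensor.inl.map _ _) }
          map_rel := by
            intro s t h w
            have hr := (LocTensor.inl (A := X.stalk w.1.1.1) (B := Y.stalk w.1.1.2)).map_rel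
              ((germHom X.presheaf w.1.1.1 w.2).map_rel h)
            have e := multiset_map_map_of (germHom X.presheaf w.1.1.1 w.2).map
              (LocTensor.inl (A := X.stalk w.1.1.1) (B := Y.stalk w.1.1.2)).map _ fun _ => rfl
            refine (congrArg₂ (LocTensor (X.stalk w.1.1.1) (Y.stalk w.1.1.2)).rel
              (Eq.trans ?_ (e s).symm) (Eq.trans ?_ (e t).symm)).mpr hr <;>
            exact multiset_map_map_of _ _ _ (fun _ => rfl) _ }
      naturality := by
        intro U V i
        refine Blpr.hom_ext fun a => BlprLocalPredicate.Sec.ext (L := localPredicate X Y)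
          fun w : (Opens.map (fstBase X Y)).obj V.unop => ?_
        exact congrArg LocTensor.inl (germHom_res (x := w.1.1.1) (U := U.unop) (V := V.unop)
          (i.unop.le w.2) w.2 i.unop.le a) }

/-- The second projection. -/
def snd : (presheafedSpace X Y).Hom Y.toPresheafedSpace where
  base := sndBase X Y
  c :=
    { app := fun U =>
        { map :=
            { toFun := fun b => ⟨fun w => LocTensor.inr (germHom Y.presheaf w.1.1.2 w.2 b),
                fun w => ⟨(Opens.map (sndBase X Y)).obj U.unop, le_rfl, ⊤, U.unop,
                  fun _ _ => trivial, fun _ h => h, 1, b, w.2, fun n hn => by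
                    refine congrArg (fun a => LocTensor.tmul a _) ?_
                    exact (map_one (germHom X.presheaf n.1.1 _).map).symm⟩⟩
              map_zero' := BlprLocalPredicate.Sec.ext (L := localPredicate X Y)
                fun w : (Opens.map (sndBase X Y)).obj U.unop =>
                (congrArg LocTensor.inr (map_zero (germHom Y.presheaf w.1.1.2 w.2).map)).trans
                  (map_zero LocTensor.inr.map)
              map_one' := BlprLocalPredicate.Sec.ext (L := localPredicate X Y)
                fun w : (Opens.map (sndBase X Y)).obj U.unop =>
                (congrArg LocTensor.inr (map_one (germHom Y.presheaf w.1.1.2 w.2).map)).trans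
                  (map_one LocTensor.inr.map)
              map_mul' := fun a b => BlprLocalPredicate.Sec.ext (L := localPredicate X Y)
                fun w : (Opens.map (sndBase X Y)).obj U.unop =>
                (congrArg LocTensor.inr (map_mul (germHom Y.presheaf w.1.1.2 w.2).map a b)).trans
                  (map_mul LocTensor.inr.map _ _) }
          map_rel := by
            intro s t h w
            have hr := (LocTensor.inr (A := X.stalk w.1.1.1) (B := Y.stalk w.1.1.2)).map_rel
              ((germHom Y.presheaf w.1.1.2 w.2).map_rel h)
            have e := multiset_map_map_of (germHom Y.presheaf w.1.1.2 w.2).map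
              (LocTensor.inr (A := X.stalk w.1.1.1) (B := Y.stalk w.1.1.2)).map _ fun _ => rfl
            refine (congrArg₂ (LocTensor (X.stalk w.1.1.1) (Y.stalk w.1.1.2)).rel
              (Eq.trans ?_ (e s).symm) (Eq.trans ?_ (e t).symm)).mpr hr <;>
            exact multiset_map_map_of _ _ _ (fun _ => rfl) _ }
      naturality := by
        intro U V i
        refine Blpr.hom_ext fun a => BlprLocalPredicate.Sec.ext (L := localPredicate X Y)
          fun w : (Opens.map (sndBase X Y)).obj V.unop => ?_
        exact congrArg LocTensor.inr (germHom_res (x := w.1.1.2) (U := U.unop) (V := V.unop)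
          (i.unop.le w.2) w.2 i.unop.le a) }

variable {X Y}

theorem evalStalk_fst (w : Pt X Y) (a : X.stalk w.1.1) :
    (localPredicate X Y).evalStalk w (stalkMap (fst X Y) w a) = LocTensor.inl a := by
  obtain ⟨U, hU, a, rfl⟩ := stalk_surj a
  rfl

theorem evalStalk_snd (w : Pt X Y) (b : Y.stalk w.1.2) :
    (localPredicate X Y).evalStalk w (stalkMap (snd X Y) w b) = LocTensor.inr b := by
  obtain ⟨U, hU, b, rfl⟩ := stalk_surj b
  rfl

/-- A section is locally a product of sections of the two factors. -/
theorem exists_res_eq_mul {W : Opens (Pt X Y)} (σ : (localPredicate X Y).presheaf.obj (op W))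
    {w : Pt X Y} (hw : w ∈ W) : ∃ (N : Opens (Pt X Y)) (_ : w ∈ N) (hN : N ≤ W)
      (U : Opens X.carrier) (V : Opens Y.carrier)
      (hU : N ≤ (Opens.map (fstBase X Y)).obj U) (hV : N ≤ (Opens.map (sndBase X Y)).obj V)
      (a : X.presheaf.obj (op U)) (b : Y.presheaf.obj (op V)),
      res (localPredicate X Y).presheaf hN σ =
        res (localPredicate X Y).presheaf hU ((fst X Y).c.app (op U) a) *
        res (localPredicate X Y).presheaf hV ((snd X Y).c.app (op V) b) := by
  obtain ⟨N, hN, U, V, hU, hV, a, b, hw, e⟩ :=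
    (show ∀ τ : (localPredicate X Y).Sec W, (localPredicate X Y).pred W τ.1 from fun τ => τ.2)
      σ ⟨w, hw⟩
  refine ⟨N, hw, hN, U, V, hU, hV, a, b,
    BlprLocalPredicate.Sec.ext (L := localPredicate X Y) fun n : N => ?_⟩
  exact (e n.1 n.2).trans (LocTensor.inl_mul_inr _ _).symm

/-- Every germ is a product `a ⊗ b` of germs of the two factors. -/
theorem exists_eq_mul (w : Pt X Y) (g : BlprStalk.stalk (localPredicate X Y).presheaf w) :
    ∃ (a : X.stalk w.1.1) (b : Y.stalk w.1.2),
      g = stalkMap (fst X Y) w a * stalkMap (snd X Y) w b := by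
  obtain ⟨W, hw, σ, rfl⟩ := stalk_surj g
  obtain ⟨N, hwN, hN, U, V, hU, hV, a, b, e⟩ := exists_res_eq_mul σ hw
  refine ⟨germHom X.presheaf w.1.1 (hU hwN) a, germHom Y.presheaf w.1.2 (hV hwN) b, ?_⟩
  rw [← germHom_res hw hwN hN, e]
  refine (map_mul (germHom _ w hwN).map _ _).trans (congrArg₂ _ ?_ ?_)
  · exact germHom_res (hU hwN) hwN hU _
  · exact germHom_res (hV hwN) hwN hV _

/-- A germ on the product is a unit if it is not mapped into the maximal ideal of some local
blueprint with local morphisms from the stalks of the factors. -/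
theorem isUnit_of_not_mem (hX : ∀ x, (X.stalk x).HasNonunitIdeal)
    (hY : ∀ y, (Y.stalk y).HasNonunitIdeal) (w : Pt X Y)
    (c : LocalCocone (X.stalk w.1.1) (Y.stalk w.1.2)) {J : Blpr.BIdeal c.pt} (hJ : J.IsMaximal)
    (g : BlprStalk.stalk (localPredicate X Y).presheaf w)
    (hg : LocTensor.descHom c ((localPredicate X Y).evalStalk w g) ∉ J.carrier) : IsUnit g := by
  obtain ⟨a, b, rfl⟩ := exists_eq_mul w g
  have e : LocTensor.descHom c ((localPredicate X Y).evalStalk w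
      (stalkMap (fst X Y) w a * stalkMap (snd X Y) w b)) = c.inl a * c.inr b := by
    have h1 : LocTensor.descHom c ((localPredicate X Y).evalStalk w (stalkMap (fst X Y) w a)) =
        c.inl a := (congrArg _ (evalStalk_fst w a)).trans (LocTensor.descHom_inl c a)
    have h2 : LocTensor.descHom c ((localPredicate X Y).evalStalk w (stalkMap (snd X Y) w b)) =
        c.inr b := (congrArg _ (evalStalk_snd w b)).trans (LocTensor.descHom_inr c b)
    rw [← h1, ← h2]
    exact (congrArg (LocTensor.descHom c)
      (map_mul ((localPredicate X Y).evalStalk w).map _ _)).trans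
      (map_mul (LocTensor.descHom c).map _ _)
  rw [e] at hg
  -- `c.inl` and `c.inr` are local, so neither factor lies in the maximal ideal of its stalk.
  have ha : IsUnit a := by
    by_contra h
    obtain ⟨I, hI, -⟩ := (hX w.1.1).isLocal
    refine hg ?_
    rw [mul_comm]
    exact J.mul_mem _ _ (c.isLocal_inl I J hI hJ a (((hX w.1.1).mem_iff hI a).2 h))
  have hb : IsUnit b := by
    by_contra h
    obtain ⟨I, hI, -⟩ := (hY w.1.2).isLocal
    exact hg (J.mul_mem _ _ (c.isLocal_inr I J hI hJ b (((hY w.1.2).mem_iff hI b).2 h)))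
  exact ((stalkMap (fst X Y) w).isUnit ha).mul ((stalkMap (snd X Y) w).isUnit hb)

/-- The morphism from a stalk of the product to a local blueprint with local morphisms from the
stalks of the factors. -/
def stalkDesc (w : Pt X Y) (c : LocalCocone (X.stalk w.1.1) (Y.stalk w.1.2)) :
    Blpr.Hom (BlprStalk.stalk (localPredicate X Y).presheaf w) c.pt :=
  (show BlprStalk.stalk (localPredicate X Y).presheaf w ⟶ _ from
    (localPredicate X Y).evalStalk w) ≫ LocTensor.descHom c

theorem hasNonunitIdeal (hX : ∀ x, (X.stalk x).HasNonunitIdeal)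
    (hY : ∀ y, (Y.stalk y).HasNonunitIdeal) (w : Pt X Y) :
    (BlprStalk.stalk (localPredicate X Y).presheaf w).HasNonunitIdeal := by
  obtain ⟨c⟩ := w.2
  obtain ⟨J, hJ, -⟩ := c.isLocal
  exact Blpr.hasNonunitIdeal_of_hom (stalkDesc w c) hJ fun g hg =>
    isUnit_of_not_mem hX hY w c hJ g hg

theorem isLocalMap_stalkDesc (hX : ∀ x, (X.stalk x).HasNonunitIdeal)
    (hY : ∀ y, (Y.stalk y).HasNonunitIdeal) (w : Pt X Y)
    (c : LocalCocone (X.stalk w.1.1) (Y.stalk w.1.2)) : Blpr.IsLocalMap (stalkDesc w c) := by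
  intro I J hI hJ g hg
  by_contra h
  exact hI.not_mem_of_isUnit (isUnit_of_not_mem hX hY w c hJ g h) hg

variable (X Y) in
/-- The product of two locally blueprinted spaces in whose stalks the non-units form ideals. -/
def prod (hX : ∀ x, (X.stalk x).HasNonunitIdeal) (hY : ∀ y, (Y.stalk y).HasNonunitIdeal) :
    LocBlprSp where
  toPresheafedSpace := presheafedSpace X Y
  IsSheaf := (localPredicate X Y).isSheaf
  isLocal w := (hasNonunitIdeal hX hY w).isLocal

variable (hX : ∀ x, (X.stalk x).HasNonunitIdeal) (hY : ∀ y, (Y.stalk y).HasNonunitIdeal)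

/-- The first projection as a local morphism. -/
def prodFst : prod X Y hX hY ⟶ X where
  toHom := fst X Y
  isLocal := by
    intro w I J hI hJ a ha
    refine ((hasNonunitIdeal hX hY w).mem_iff hJ _).2 fun hu => ?_
    obtain ⟨c⟩ := w.2
    obtain ⟨K, hK, -⟩ := c.isLocal
    refine hK.not_mem_of_isUnit ((stalkDesc w c).isUnit hu) ?_
    have e : stalkDesc w c (stalkMap (fst X Y) w a) = c.inl a :=
      (congrArg (LocTensor.descHom c) (evalStalk_fst w a)).trans (LocTensor.descHom_inl c a)
    exact (congrArg (· ∈ K.carrier) e).mpr (c.isLocal_inl I K hI hK a ha)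

/-- The second projection as a local morphism. -/
def prodSnd : prod X Y hX hY ⟶ Y where
  toHom := snd X Y
  isLocal := by
    intro w I J hI hJ a ha
    refine ((hasNonunitIdeal hX hY w).mem_iff hJ _).2 fun hu => ?_
    obtain ⟨c⟩ := w.2
    obtain ⟨K, hK, -⟩ := c.isLocal
    refine hK.not_mem_of_isUnit ((stalkDesc w c).isUnit hu) ?_
    have e : stalkDesc w c (stalkMap (snd X Y) w a) = c.inr a :=
      (congrArg (LocTensor.descHom c) (evalStalk_snd w a)).trans (LocTensor.descHom_inr c a)
    exact (congrArg (· ∈ K.carrier) e).mpr (c.isLocal_inr I K hI hK a ha)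

end LocBlprProd

namespace LocBlprProd

open BlprStalk BlprSp

variable {X Y : LocBlprSp}

section Lift

variable {T : LocBlprSp} (f : T ⟶ X) (g : T ⟶ Y)

/-- A stalk of `T` receives local morphisms from the stalks of `X` and `Y`. -/
def liftCocone (t : T.carrier) : LocalCocone (X.stalk (f.base t)) (Y.stalk (g.base t)) where
  pt := T.stalk t
  isLocal := T.isLocal t
  inl := stalkMap f.toHom t
  inr := stalkMap g.toHom t
  isLocal_inl := f.isLocal t
  isLocal_inr := g.isLocal t

/-- The map of points to the product. -/
def liftBase : T.carrier ⟶ Pt X Y :=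
  TopCat.ofHom ⟨fun t => ⟨(f.base t, g.base t), ⟨liftCocone f g t⟩⟩,
    (f.base.hom.continuous.prodMk g.base.hom.continuous).subtype_mk _⟩

theorem exists_liftSec {W : Opens (Pt X Y)} (σ : (localPredicate X Y).Sec W) :
    ∃ τ : T.presheaf.obj (op ((Opens.map (liftBase f g)).obj W)),
      ∀ (t : T.carrier) (ht : liftBase f g t ∈ W), germ T.presheaf t
        (U := (Opens.map (liftBase f g)).obj W) ht τ =
          LocTensor.desc (liftCocone f g t) (σ.1 ⟨liftBase f g t, ht⟩) := by
  refine exists_section_of_germs T.IsSheaf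
    (fun t ht => LocTensor.desc (liftCocone f g t) (σ.1 ⟨liftBase f g t, ht⟩)) fun t ht => ?_
  obtain ⟨N, hN, U, V, hU, hV, a, b, hw, e⟩ := σ.2 ⟨liftBase f g t, ht⟩
  have hNU : (Opens.map (liftBase f g)).obj N ≤ (Opens.map f.base).obj U :=
    fun s hs => hU (liftBase f g s) hs
  have hNV : (Opens.map (liftBase f g)).obj N ≤ (Opens.map g.base).obj V :=
    fun s hs => hV (liftBase f g s) hs
  refine ⟨(Opens.map (liftBase f g)).obj N, hw, fun s hs => hN hs,
    res T.presheaf hNU (f.c.app (op U) a) * res T.presheaf hNV (g.c.app (op V) b),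
    fun s hs => ?_⟩
  refine Eq.trans ?_ (congrArg (LocTensor.desc (liftCocone f g s)) (e (liftBase f g s) hs)).symm
  refine (germ_mul' _ _ _).trans (congrArg₂ _ ?_ ?_)
  · exact germ_res (hNU hs) hs hNU _
  · exact germ_res (hNV hs) hs hNV _

/-- The pullback of sections of the product. -/
noncomputable def liftSec {W : Opens (Pt X Y)} (σ : (localPredicate X Y).Sec W) :
    T.presheaf.obj (op ((Opens.map (liftBase f g)).obj W)) := (exists_liftSec f g σ).choose

theorem germ_liftSec {W : Opens (Pt X Y)} (σ : (localPredicate X Y).Sec W) (t : T.carrier)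
    (ht : liftBase f g t ∈ W) :
    germ T.presheaf t (U := (Opens.map (liftBase f g)).obj W) ht (liftSec f g σ) =
      LocTensor.desc (liftCocone f g t) (σ.1 ⟨liftBase f g t, ht⟩) :=
  (exists_liftSec f g σ).choose_spec t ht

/-- The morphism of presheafed spaces to the product. -/
noncomputable def liftHom : T.toPresheafedSpace.Hom (presheafedSpace X Y) where
  base := liftBase f g
  c :=
    { app := fun W =>
        { map :=
            { toFun := fun σ => liftSec f g (W := W.unop) σ
              map_zero' := eq_of_germ_eq T.IsSheaf _ _ fun t ht =>
                ((germ_liftSec f g (W := W.unop) _ t ht).trans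
                  (map_zero (LocTensor.desc (liftCocone f g t)))).trans (germ_zero _).symm
              map_one' := eq_of_germ_eq T.IsSheaf _ _ fun t ht =>
                ((germ_liftSec f g (W := W.unop) _ t ht).trans
                  (map_one (LocTensor.desc (liftCocone f g t)))).trans (germ_one _).symm
              map_mul' := fun σ σ' => eq_of_germ_eq T.IsSheaf _ _ fun t ht => by
                refine (germ_liftSec f g (W := W.unop) _ t ht).trans ?_
                refine (map_mul (LocTensor.desc (liftCocone f g t)) _ _).trans ?_
                refine Eq.trans ?_ (germ_mul' _ _ _).symm
                exact congrArg₂ _ (germ_liftSec f g (W := W.unop) σ t ht).symm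
                  (germ_liftSec f g (W := W.unop) σ' t ht).symm }
          map_rel := by
            intro σ σ' h
            refine rel_of_germ_rel T.IsSheaf _ _ fun t ht => ?_
            have hr := (LocTensor.descHom (liftCocone f g t)).map_rel (h ⟨liftBase f g t, ht⟩)
            have e := multiset_map_map_of
              (BlprLocalPredicate.Sec.eval (L := localPredicate X Y) ⟨liftBase f g t, ht⟩)
              (LocTensor.desc (liftCocone f g t)) _ fun _ => rfl
            have e' := multiset_map_map_of (fun σ => liftSec f g (W := W.unop) σ)
              (germ T.presheaf t (U := (Opens.map (liftBase f g)).obj W.unop) ht) _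
              fun σ => germ_liftSec f g σ t ht
            exact (congrArg₂ (T.stalk t).rel ((e' σ).trans (e σ).symm)
              ((e' σ').trans (e σ').symm)).mpr hr }
      naturality := by
        intro W W' i
        refine Blpr.hom_ext fun σ => eq_of_germ_eq T.IsSheaf _ _ fun t ht => ?_
        refine (germ_liftSec f g (W := W'.unop) _ t ht).trans ?_
        refine Eq.trans ?_ (germ_res (U := (Opens.map (liftBase f g)).obj W.unop)
          (i.unop.le ht) ht (fun _ h => i.unop.le h) _).symm
        exact (germ_liftSec f g (W := W.unop) σ t (i.unop.le ht)).symm }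

variable (hX : ∀ x, (X.stalk x).HasNonunitIdeal) (hY : ∀ y, (Y.stalk y).HasNonunitIdeal)

/-- The morphism to the product. -/
noncomputable def lift : T ⟶ prod X Y hX hY where
  toHom := liftHom f g
  isLocal := by
    intro t I J hI hJ σ hσ
    have h := isLocalMap_stalkDesc hX hY (liftBase f g t) (liftCocone f g t) I J hI hJ σ hσ
    obtain ⟨W, hW, σ, rfl⟩ := stalk_surj σ
    exact (congrArg (· ∈ J.carrier) (germ_liftSec f g (W := W) σ t hW)).mpr h

theorem lift_fst : lift f g hX hY ≫ prodFst hX hY = f := by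
  refine LocBlprSp.hom_ext (fun _ => rfl) fun t U hf hg a => ?_
  refine (germ_liftSec f g (W := (Opens.map (fstBase X Y)).obj U) _ t hf).trans ?_
  exact LocTensor.descHom_inl (liftCocone f g t) (germHom X.presheaf (f.base t) hg a)

theorem lift_snd : lift f g hX hY ≫ prodSnd hX hY = g := by
  refine LocBlprSp.hom_ext (fun _ => rfl) fun t U hf hg a => ?_
  refine (germ_liftSec f g (W := (Opens.map (sndBase X Y)).obj U) _ t hf).trans ?_
  exact LocTensor.descHom_inr (liftCocone f g t) (germHom Y.presheaf (g.base t) hg a)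

/-- The pullback of a section of the product is determined near a point by the compositions with
the projections. -/
theorem germ_app {hX : ∀ x, (X.stalk x).HasNonunitIdeal}
    {hY : ∀ y, (Y.stalk y).HasNonunitIdeal} (m : T ⟶ prod X Y hX hY) (t : T.carrier)
    {W N : Opens (Pt X Y)} (hN : N ≤ W) (ht : m.base t ∈ N) {U : Opens X.carrier}
    {V : Opens Y.carrier} (hU : N ≤ (Opens.map (fstBase X Y)).obj U)
    (hV : N ≤ (Opens.map (sndBase X Y)).obj V) (a : X.presheaf.obj (op U))
    (b : Y.presheaf.obj (op V)) (σ : (localPredicate X Y).presheaf.obj (op W))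
    (e : res (localPredicate X Y).presheaf hN σ =
        res (localPredicate X Y).presheaf hU ((fst X Y).c.app (op U) a) *
        res (localPredicate X Y).presheaf hV ((snd X Y).c.app (op V) b)) :
    germHom T.presheaf t (U := (Opens.map m.base).obj W) (hN ht) (m.c.app (op W) σ) =
      germHom T.presheaf t (U := (Opens.map (m ≫ prodFst hX hY).base).obj U) (hU ht)
        ((m ≫ prodFst hX hY).c.app (op U) a) *
      germHom T.presheaf t (U := (Opens.map (m ≫ prodSnd hX hY).base).obj V) (hV ht)
        ((m ≫ prodSnd hX hY).c.app (op V) b) := by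
  have e' := congrArg (fun s => stalkMap m.toHom t
    (germHom (localPredicate X Y).presheaf (m.base t) ht s)) e
  have h1 := germHom_res (F := (localPredicate X Y).presheaf) (hN ht) ht hN σ
  have h2 := germHom_res (F := (localPredicate X Y).presheaf) (hU ht) ht hU
    ((fst X Y).c.app (op U) a)
  have h3 := germHom_res (F := (localPredicate X Y).presheaf) (hV ht) ht hV
    ((snd X Y).c.app (op V) b)
  refine ((congrArg (stalkMap m.toHom t) h1).symm.trans e').trans ?_
  refine (congrArg (stalkMap m.toHom t) (map_mul (germHom (localPredicate X Y).presheaf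
    (m.base t) ht).map _ _)).trans ?_
  refine (map_mul (stalkMap m.toHom t).map _ _).trans ?_
  exact congrArg₂ _ (congrArg (stalkMap m.toHom t) h2) (congrArg (stalkMap m.toHom t) h3)

theorem hom_ext {hX : ∀ x, (X.stalk x).HasNonunitIdeal}
    {hY : ∀ y, (Y.stalk y).HasNonunitIdeal} {m m' : T ⟶ prod X Y hX hY}
    (h : m ≫ prodFst hX hY = m' ≫ prodFst hX hY) (h' : m ≫ prodSnd hX hY = m' ≫ prodSnd hX hY) :
    m = m' := by
  have hb : ∀ t, m.base t = m'.base t := fun t => by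
    refine Subtype.ext (Prod.ext ?_ ?_)
    · exact congrArg (fun k : T ⟶ X => k.base t) h
    · exact congrArg (fun k : T ⟶ Y => k.base t) h'
  refine LocBlprSp.hom_ext hb fun t W hW hW' σ => ?_
  obtain ⟨N, hw, hN, U, V, hU, hV, a, b, e⟩ := exists_res_eq_mul σ hW
  have hw' : m'.base t ∈ N := hb t ▸ hw
  refine (germ_app m t hN hw hU hV a b σ e).trans
    (Eq.trans ?_ (germ_app m' t hN hw' hU hV a b σ e).symm)
  have aux : ∀ {Z : LocBlprSp} {k k' : T ⟶ Z} (_ : k = k') {U : Opens Z.carrier}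
      (hk : k.base t ∈ U) (hk' : k'.base t ∈ U) (a : Z.presheaf.obj (op U)),
      germHom T.presheaf t (U := (Opens.map k.base).obj U) hk (k.c.app (op U) a) =
      germHom T.presheaf t (U := (Opens.map k'.base).obj U) hk' (k'.c.app (op U) a) := by
    rintro Z k _ rfl U _ _ a
    rfl
  exact congrArg₂ _ (aux h _ _ _) (aux h' _ _ _)

end Lift

/-- Over a base to which there is at most one morphism, the product is the fiber product. -/
theorem isPullback (hX : ∀ x, (X.stalk x).HasNonunitIdeal)
    (hY : ∀ y, (Y.stalk y).HasNonunitIdeal) {S : LocBlprSp} (p : X ⟶ S) (q : Y ⟶ S)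
    (hS : ∀ {T : LocBlprSp} (f g : T ⟶ S), f = g) :
    IsPullback (prodFst hX hY) (prodSnd hX hY) p q :=
  ⟨⟨hS _ _⟩, ⟨PullbackCone.IsLimit.mk _ (fun s => lift s.fst s.snd hX hY)
    (fun s => lift_fst s.fst s.snd hX hY) (fun s => lift_snd s.fst s.snd hX hY)
    fun s _ h h' => hom_ext (h.trans (lift_fst s.fst s.snd hX hY).symm)
      (h'.trans (lift_snd s.fst s.snd hX hY).symm)⟩⟩

end LocBlprProd

/-! ### The point `Spec 𝔽_{1²}` is subterminal -/

namespace Blpr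

/-- An additive inverse in a blueprint is unique. -/
theorem eq_of_add_eq_zero (B : Blpr) {a b c : B} (hb : B.rel {a, b} 0) (hc : B.rel {a, c} 0) :
    b = c := by
  refine B.pre.proper ?_
  have h1 : B.rel {b, a, c} {b} := by
    have := B.pre.add (B.pre.refl {b}) hc
    rwa [add_zero, Multiset.singleton_add] at this
  have h2 : B.rel {b, a, c} {c} := by
    have := B.pre.add hb (B.pre.refl {c})
    rw [zero_add] at this
    have e : ({b, a, c} : Multiset B) = {a, b} + {c} := by
      simp only [Multiset.insert_eq_cons, Multiset.cons_add, Multiset.singleton_add]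
      rw [Multiset.cons_swap]
    rw [e]
    exact this
  exact B.pre.trans (B.pre.symm h1) h2

end Blpr

/-- Morphisms out of the sections of `Spec 𝔽_{1²}` are unique: the image of `-1` is an additive
inverse of `1`. -/
theorem f12Model_hom_unique {U : Opens PUnit} (hU : PUnit.unit ∈ U) {B : Blpr}
    (φ ψ : Blpr.Hom (f12Model.secBlpr U) B) (a : f12Model.Sec U) : φ a = ψ a := by
  obtain ⟨q, hq⟩ := a.2
  rcases (hq ⟨_, hU⟩).2 with rfl | rfl | rfl
  · have : a = 0 := RatModel.Sec.ext fun x => (hq x).1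
    rw [this]
    exact (map_zero φ.map).trans (map_zero ψ.map).symm
  · have : a = 1 := RatModel.Sec.ext fun x => (hq x).1
    rw [this]
    exact (map_one φ.map).trans (map_one ψ.map).symm
  · have hr : (f12Model.secBlpr U).rel {(1 : f12Model.Sec U), a} 0 := by
      intro x
      have := f12Model.neg_one_rel x.1
      rw [← (hq x).1] at this
      exact this
    have e : ∀ χ : Blpr.Hom (f12Model.secBlpr U) B, B.rel {1, χ a} 0 := by
      intro χ
      have h := χ.map_rel hr
      have h1 : χ (1 : f12Model.Sec U) = 1 := map_one χ.map
      rw [← h1]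
      exact h
    exact B.eq_of_add_eq_zero (e φ) (e ψ)

theorem specF12.hom_subsingleton {T : LocBlprSp} (f g : T ⟶ specF12) : f = g := by
  refine LocBlprSp.hom_ext (fun _ => rfl) fun t U hf hg a => ?_
  exact f12Model_hom_unique hf
    ((f.c.app (op U) : _ ⟶ _) ≫ (show T.presheaf.obj (op ((Opens.map f.base).obj U)) ⟶ T.stalk t
      from BlprStalk.germHom T.presheaf t (U := (Opens.map f.base).obj U) hf))
    ((g.c.app (op U) : _ ⟶ _) ≫ (show T.presheaf.obj (op ((Opens.map g.base).obj U)) ⟶ T.stalk t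
      from BlprStalk.germHom T.presheaf t (U := (Opens.map g.base).obj U) hg)) a

/-! ### Stalks of sheaves of rational constants -/

namespace RatModel

open BlprStalk

variable {X : Type} [TopologicalSpace X] (M : RatModel X) (x : X)

/-- The value of a germ of rational constants. -/
def stalkVal : Germ M.presheaf x →*₀ ℚ where
  toFun := Quotient.lift (fun p => (p.val : M.Sec p.U).1 ⟨x, p.mem⟩) (by
    rintro ⟨U, hU, a⟩ ⟨V, hV, b⟩ ⟨W, hW, h, h', e⟩
    exact congrArg (fun g : M.Sec W => g.1 ⟨x, hW⟩) e)
  map_zero' := rfl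
  map_one' := rfl
  map_mul' := by
    intro g g'
    obtain ⟨U, hU, a, b, rfl, rfl⟩ := germ_surj₂ g g'
    rfl

theorem stalkVal_mem (g : Germ M.presheaf x) : M.stalkVal x g ∈ M.A x := by
  obtain ⟨U, hU, a, rfl⟩ := germ_surj g
  obtain ⟨q, hq⟩ := (show ∀ a : M.Sec U, ∃ q : ℚ, ∀ x : U, a.1 x = q ∧ q ∈ M.A x from
    fun a => a.2) a
  refine (congrArg (· ∈ M.A x) (hq ⟨x, hU⟩).1).mpr (hq ⟨x, hU⟩).2

theorem stalkVal_rel {s t : Multiset (Germ M.presheaf x)}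
    (h : (stalk M.presheaf x).rel s t) :
    (M.pre x).rel (s.map (M.stalkVal x)) (t.map (M.stalkVal x)) := by
  obtain ⟨U, hU, s, t, h, rfl, rfl⟩ := h
  have e := multiset_map_map_of (germ M.presheaf x hU) (M.stalkVal x)
    (Sec.eval (M := M) ⟨x, hU⟩) fun _ => rfl
  exact (congrArg₂ (M.pre x).rel (e s) (e t)).mpr (h ⟨x, hU⟩)

theorem isUnit_germ_iff (g : Germ M.presheaf x) :
    IsUnit g ↔ M.stalkVal x g ≠ 0 ∧ (M.stalkVal x g)⁻¹ ∈ M.A x := by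
  constructor
  · rintro ⟨u, rfl⟩
    have h : M.stalkVal x ↑u * M.stalkVal x ↑u⁻¹ = 1 := by rw [← map_mul, Units.mul_inv, map_one]
    refine ⟨left_ne_zero_of_mul_eq_one h, ?_⟩
    rw [inv_eq_of_mul_eq_one_right h]
    exact M.stalkVal_mem x _
  · rintro ⟨h0, hinv⟩
    obtain ⟨U, hU, a, rfl⟩ := germ_surj g
    obtain ⟨q, hq⟩ := (show ∀ a : M.Sec U, ∃ q : ℚ, ∀ x : U, a.1 x = q ∧ q ∈ M.A x from
      fun a => a.2) a
    have e : M.stalkVal x (germ M.presheaf x hU a) = q := (hq ⟨x, hU⟩).1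
    rw [e] at h0 hinv
    let W : Opens X := U ⊓ ⟨_, M.isOpen q⁻¹⟩
    have hW : x ∈ W := ⟨hU, hinv⟩
    let b : M.presheaf.obj (op W) :=
      (⟨fun _ => q⁻¹, q⁻¹, fun y => ⟨rfl, y.2.2⟩⟩ : M.Sec W)
    have hWU : W ≤ U := inf_le_left
    have key : germ M.presheaf x hU a * germ M.presheaf x hW b = 1 := by
      rw [← germ_res hU hW hWU a, ← germ_mul', ← germ_one hW]
      refine congrArg (germ M.presheaf x hW) (Sec.ext fun y => ?_)
      exact (congrArg (· * q⁻¹) (hq ⟨y.1, hWU y.2⟩).1).trans (mul_inv_cancel₀ h0)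
    exact IsUnit.of_mul_eq_one _ key

theorem hasNonunitIdeal_stalk : (stalk M.presheaf x).HasNonunitIdeal := by
  have hz : ∀ g : Germ M.presheaf x, ¬ IsUnit g → M.stalkVal x g ∈ M.A x ∧
      (M.stalkVal x g = 0 ∨ (M.stalkVal x g)⁻¹ ∉ M.A x) := fun g hg =>
    ⟨M.stalkVal_mem x g, by rwa [isUnit_germ_iff, not_and_or, not_not] at hg⟩
  refine ⟨{
    carrier := {g | ¬ IsUnit (g : Germ M.presheaf x)}
    zero_mem := fun h => ((M.isUnit_germ_iff x _).1 h).1 (map_zero _)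
    mul_mem := fun a b hb h => hb (isUnit_of_mul_isUnit_right h)
    rel_mem := ?_ }, fun _ => Iff.rfl⟩
  intro (c : Germ M.presheaf x) (s : Multiset (Germ M.presheaf x))
    (t : Multiset (Germ M.presheaf x)) hs ht hr hc
  have hr' := M.stalkVal_rel x hr
  have hr' := (congrArg (fun u => (M.pre x).rel u _)
    (Multiset.map_cons (M.stalkVal x) c s)).mp hr'
  obtain ⟨h0, hinv⟩ := (M.isUnit_germ_iff x c).1 hc
  refine M.unit_rel x _ _ _ (M.stalkVal_mem x c) h0 hinv ?_ ?_ hr'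
  · intro a ha
    obtain ⟨g, hg, rfl⟩ := Multiset.mem_map.1 ha
    exact hz g (hs g hg)
  · intro a ha
    obtain ⟨g, hg, rfl⟩ := Multiset.mem_map.1 ha
    exact hz g (ht g hg)

end RatModel

/-! ### Local morphisms to the field of rational numbers -/

/-- The field of rational numbers as a blueprint. -/
def ratField : Blpr where
  carrier := ℚ
  pre := ratAdd

theorem ratField.hasNonunitIdeal : ratField.HasNonunitIdeal := by
  have hu : ∀ q : ℚ, q = 0 ↔ ¬ IsUnit q := fun q => by rw [isUnit_iff_ne_zero, not_not]
  refine ⟨{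
    carrier := {q : ℚ | q = 0}
    zero_mem := rfl
    mul_mem := fun a b (hb : b = (0 : ℚ)) => (congrArg (a * ·) hb).trans (mul_zero (a : ℚ))
    rel_mem := ?_ }, hu⟩
  intro (c : ℚ) (s : Multiset ℚ) (t : Multiset ℚ) hs ht (hr : (c ::ₘ s).sum = t.sum)
  rw [Multiset.sum_cons, Multiset.sum_eq_zero hs, Multiset.sum_eq_zero ht, add_zero] at hr
  exact hr

/-- Related formal sums have the same sum of values under every odd function: the pre-addition
`ratMul` is contained in the one defined by all odd functions. -/
theorem ratMul_sum_map {s t : Multiset ℚ} (h : ratMul.rel s t) (φ : ℚ → ℚ)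
    (hφ : ∀ q, φ (-q) = -φ q) : (s.map φ).sum = (t.map φ).sum := by
  have h0 : ∀ ψ : ℚ → ℚ, (∀ q, ψ (-q) = -ψ q) → ψ 0 = 0 := fun ψ hψ => by
    have := hψ 0
    rw [neg_zero] at this
    linarith
  let R : PreAddition ℚ :=
    { rel := fun s t => ∀ ψ : ℚ → ℚ, (∀ q, ψ (-q) = -ψ q) → (s.map ψ).sum = (t.map ψ).sum
      refl := fun _ _ _ => rfl
      symm := fun h ψ hψ => (h ψ hψ).symm
      trans := fun h h' ψ hψ => (h ψ hψ).trans (h' ψ hψ)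
      add := fun h h' ψ hψ => by
        rw [Multiset.map_add, Multiset.map_add, Multiset.sum_add, Multiset.sum_add, h ψ hψ,
          h' ψ hψ]
      mul := fun a s t h ψ hψ => by
        rw [Multiset.map_map, Multiset.map_map]
        exact h (fun q => ψ (a * q)) fun q => by rw [mul_neg, hψ]
      zero := fun ψ hψ => by simpa using h0 ψ hψ
      proper := fun h => by simpa using h id fun _ => rfl }
  refine ratMul_le R (fun ψ hψ => ?_) h φ hφ
  have := hψ 1
  simp [this]

namespace RatModel

open BlprStalk

variable {X : Type} [TopologicalSpace X] (M : RatModel X) (x : X)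

/-- A local morphism from the stalk to the field of rational numbers. -/
def HasLocalMapToRat : Prop :=
  ∃ f : Blpr.Hom (stalk M.presheaf x) ratField, Blpr.IsLocalMap f

variable {M x}

theorem isLocalMap_ratField (f : Blpr.Hom (stalk M.presheaf x) ratField)
    (hf : ∀ g : Germ M.presheaf x, ¬ IsUnit g → f g = (0 : ℚ)) : Blpr.IsLocalMap f := by
  intro I J hI hJ g hg
  have h : f g = (0 : ℚ) := hf g (((M.hasNonunitIdeal_stalk x).mem_iff hI g).1 hg)
  exact (congrArg (· ∈ J.carrier) h).mpr J.zero_mem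

/-- If the stalk is all of `ℚ`, the value of germs is a local morphism to the rational numbers. -/
theorem hasLocalMapToRat_of_eq_top (hA : M.A x = ⊤)
    (hpre : ∀ s t, (M.pre x).rel s t → s.sum = t.sum) : M.HasLocalMapToRat x := by
  refine ⟨⟨M.stalkVal x, fun h => hpre _ _ (M.stalkVal_rel x h)⟩,
    isLocalMap_ratField _ fun g hg => ?_⟩
  change M.stalkVal x g = 0
  by_contra h
  refine hg ((M.isUnit_germ_iff x g).2 ⟨h, ?_⟩)
  rw [hA]
  trivial

/-- If no sums other than `a + (-a) ≡ 0` are retained at `x`, sending non-units to `0` and units to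
their signs is a local morphism to the rational numbers. -/
theorem hasLocalMapToRat_of_pre_eq (hpre : M.pre x = ratMul) : M.HasLocalMapToRat x := by
  classical
  let φ : ℚ → ℚ := fun q => if q ≠ 0 ∧ q⁻¹ ∈ M.A x then (SignType.sign q : ℚ) else 0
  have hodd : ∀ q, φ (-q) = -φ q := by
    intro q
    have hiff : -q ≠ 0 ∧ (-q)⁻¹ ∈ M.A x ↔ q ≠ 0 ∧ q⁻¹ ∈ M.A x := by
      have key : ∀ r : ℚ, r ∈ M.A x → -r ∈ M.A x := fun r hr => by
        simpa using (M.A x).mul_mem (M.neg_one_mem x) hr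
      rw [inv_neg, neg_ne_zero]
      refine and_congr_right fun _ => ⟨fun h => ?_, key _⟩
      simpa using key _ h
    by_cases h : q ≠ 0 ∧ q⁻¹ ∈ M.A x
    · simp only [φ, if_pos h, if_pos (hiff.2 h), Left.sign_neg, SignType.coe_neg]
    · simp only [φ, if_neg h, if_neg fun h' => h (hiff.1 h'), neg_zero]
  have hφ : ∀ g : Germ M.presheaf x, φ (M.stalkVal x g) =
      if IsUnit g then (SignType.sign (M.stalkVal x g) : ℚ) else 0 := fun g =>
    if_congr (M.isUnit_germ_iff x g).symm rfl rfl
  refine ⟨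
    { map :=
        { toFun := fun g => φ (M.stalkVal x g)
          map_zero' := by
            have : M.stalkVal x (0 : Germ M.presheaf x) = 0 := map_zero _
            exact (congrArg φ this).trans (if_neg fun h => h.1 rfl)
          map_one' := by
            have : M.stalkVal x (1 : Germ M.presheaf x) = 1 := map_one _
            refine (congrArg φ this).trans ?_
            have h1 : (1 : ℚ) ≠ 0 ∧ (1 : ℚ)⁻¹ ∈ M.A x := ⟨one_ne_zero, by simp⟩
            simp only [φ, if_pos h1, sign_one, SignType.coe_one]
            rfl
          map_mul' := fun (g : Germ M.presheaf x) (g' : Germ M.presheaf x) => by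
            refine Eq.trans (b := (φ (M.stalkVal x g) * φ (M.stalkVal x g') : ℚ)) ?_ rfl
            refine (hφ (g * g')).trans ?_
            rw [hφ g, hφ g', map_mul, sign_mul, SignType.coe_mul]
            by_cases hg : IsUnit g
            · by_cases hg' : IsUnit g'
              · rw [if_pos hg, if_pos hg', if_pos (hg.mul hg')]
              · rw [if_neg hg', if_neg fun h => hg' (isUnit_of_mul_isUnit_right h), mul_zero]
            · rw [if_neg hg, if_neg fun h => hg (isUnit_of_mul_isUnit_left h), zero_mul] }
      map_rel := ?_ }, isLocalMap_ratField _ fun g hg => (hφ g).trans (if_neg hg)⟩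
  intro s t h
  have h1 := M.stalkVal_rel x h
  rw [hpre] at h1
  have h2 := ratMul_sum_map h1 φ hodd
  have e : ∀ u : Multiset (Germ M.presheaf x), (u.map (M.stalkVal x)).map φ =
      u.map fun g => φ (M.stalkVal x g) := multiset_map_map_of _ _ _ fun _ => rfl
  exact (congrArg Multiset.sum (e s)).symm.trans (h2.trans (congrArg Multiset.sum (e t)))

end RatModel

/-! ### The Krull dimension of products of arithmetic curves -/

/-- An irreducible closed subset of a product space is the product of the closures of its
projections. -/
theorem IsIrreducible.mem_of_mem_closure_image {X Y : Type*} [TopologicalSpace X]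
    [TopologicalSpace Y] {Z : Set (X × Y)} (hZ : IsIrreducible Z) (hc : IsClosed Z) {z : X × Y}
    (h1 : z.1 ∈ closure (Prod.fst '' Z)) (h2 : z.2 ∈ closure (Prod.snd '' Z)) : z ∈ Z := by
  rw [← hc.closure_eq, mem_closure_iff]
  intro O hO hz
  obtain ⟨U, V, hU, hV, hzU, hzV, hUV⟩ := isOpen_prod_iff.1 hO z.1 z.2 hz
  obtain ⟨_, hu, u, huZ, rfl⟩ := mem_closure_iff.1 h1 U hU hzU
  obtain ⟨_, hv, v, hvZ, rfl⟩ := mem_closure_iff.1 h2 V hV hzV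
  obtain ⟨w, hwZ, hwU, hwV⟩ := hZ.isPreirreducible _ _ (hU.preimage continuous_fst)
    (hV.preimage continuous_snd) ⟨u, huZ, hu⟩ ⟨v, hvZ, hv⟩
  exact ⟨w, hUV ⟨hwU, hwV⟩, hwZ⟩

namespace ArithPt

variable {S : Set Place}

theorem isClosed_singleton_closed (v : S) : IsClosed ({closed v} : Set (ArithPt S)) := by
  refine ⟨Or.inr ⟨by simp, ?_⟩⟩
  rw [compl_compl]
  exact Set.finite_singleton _

theorem generic_specializes (x : ArithPt S) : (generic : ArithPt S) ⤳ x := by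
  rw [specializes_iff_forall_open]
  intro U hU hx
  exact ((isOpen_iff.1 hU).resolve_left (Set.nonempty_iff_ne_empty.1 ⟨x, hx⟩)).1

theorem eq_univ_of_generic_mem {C : Set (ArithPt S)} (hC : IsClosed C) (h : generic ∈ C) :
    C = Set.univ := by
  refine Set.eq_univ_of_forall fun x => ?_
  exact (generic_specializes x).mem_closed hC h

/-- The only irreducible closed subsets are the whole space and the closed points. -/
theorem eq_of_subset {C D : Set (ArithPt S)} (hC : IsClosed C) (hCne : C.Nonempty)
    (hD : IsClosed D) (hDi : IsIrreducible D) (h : C ⊆ D) (hg : generic ∈ D → generic ∈ C) :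
    C = D := by
  by_cases hgD : generic ∈ D
  · rw [eq_univ_of_generic_mem hC (hg hgD), eq_univ_of_generic_mem hD hgD]
  · refine Set.Subset.antisymm h fun b hb => ?_
    obtain ⟨a, ha⟩ := hCne
    have hDf : D.Finite := by
      have := ((isOpen_iff.1 hD.isOpen_compl).resolve_left
        (Set.nonempty_iff_ne_empty.1 ⟨_, hgD⟩)).2
      rwa [compl_compl] at this
    -- Otherwise `D` is covered by its proper closed subsets `C` and `D \ C`.
    by_contra hbC
    have hopen : ∀ F : Set (ArithPt S), F ⊆ D → IsOpen Fᶜ := fun F hF =>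
      Or.inr ⟨fun hgF => hgD (hF hgF), by rw [compl_compl]; exact hDf.subset hF⟩
    obtain ⟨c, hcD, hc1, hc2⟩ := hDi.isPreirreducible _ _ (hopen C h)
      (hopen (D \ C) Set.sdiff_subset) ⟨b, hb, hbC⟩ ⟨a, h ha, fun h' => h'.2 ha⟩
    exact hc2 ⟨hcD, hc1⟩

theorem topologicalKrullDim_prod_le : topologicalKrullDim (ArithPt S × ArithPt S) ≤ 2 := by
  classical
  let d : Set (ArithPt S) → ℕ := fun C => if generic ∈ closure C then 1 else 0
  have hd : ∀ {C D}, C ⊆ D → d C ≤ d D := by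
    intro C D h
    by_cases hC : generic ∈ closure C
    · simp only [d, if_pos hC, if_pos (closure_mono h hC), le_refl]
    · simp only [d, if_neg hC, zero_le]
  have hd1 : ∀ C, d C ≤ 1 := fun C => by
    by_cases hC : generic ∈ closure C
    · simp only [d, if_pos hC, le_refl]
    · simp only [d, if_neg hC, zero_le]
  have heq : ∀ {C D : Set (ArithPt S)}, C.Nonempty → IsIrreducible D → C ⊆ D → d D ≤ d C →
      closure C = closure D := by
    intro C D hC hD h hdD
    refine eq_of_subset isClosed_closure hC.closure isClosed_closure hD.closure (closure_mono h)
      fun hg => ?_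
    by_contra hgC
    simp only [d, if_pos hg, if_neg hgC] at hdD
    omega
  -- The number of generic coordinates of the generic point of an irreducible closed subset.
  let r : IrreducibleCloseds (ArithPt S × ArithPt S) → ℕ := fun Z =>
    d (Prod.fst '' (Z : Set (ArithPt S × ArithPt S))) +
      d (Prod.snd '' (Z : Set (ArithPt S × ArithPt S)))
  have hr : StrictMono r := by
    intro Z W h
    have hZW : (Z : Set (ArithPt S × ArithPt S)) ⊆ W := h.le
    have h1 := hd (Set.image_mono (f := Prod.fst) hZW)
    have h2 := hd (Set.image_mono (f := Prod.snd) hZW)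
    by_contra hlt
    have hlt' : d (Prod.fst '' (W : Set (ArithPt S × ArithPt S))) +
      d (Prod.snd '' (W : Set (ArithPt S × ArithPt S))) ≤
      d (Prod.fst '' (Z : Set (ArithPt S × ArithPt S))) +
      d (Prod.snd '' (Z : Set (ArithPt S × ArithPt S))) := not_lt.1 hlt
    have e1 := heq (Z.isIrreducible.nonempty.image Prod.fst)
      (W.isIrreducible.image Prod.fst continuous_fst.continuousOn) (Set.image_mono hZW) (by omega)
    have e2 := heq (Z.isIrreducible.nonempty.image Prod.snd)
      (W.isIrreducible.image Prod.snd continuous_snd.continuousOn) (Set.image_mono hZW) (by omega)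
    refine h.not_ge fun w hw => ?_
    refine Z.isIrreducible.mem_of_mem_closure_image Z.isClosed ?_ ?_
    · rw [e1]
      exact subset_closure ⟨w, hw, rfl⟩
    · rw [e2]
      exact subset_closure ⟨w, hw, rfl⟩
  refine iSup_le fun p => ?_
  have h1 := (p.map r hr).head_add_length_le_nat
  have h2 : (p.map r hr).last ≤ 2 := by
    rw [LTSeries.last_map]
    exact add_le_add (hd1 _) (hd1 _)
  have h3 : (p.map r hr).length = p.length := rfl
  have h4 : p.length ≤ 2 := by omega
  exact_mod_cast h4

end ArithPt

/-- Three points, each a specialization of the preceding one, span a chain of irreducible closed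
subsets if closed subsets separate them. -/
theorem two_le_topologicalKrullDim {X : Type*} [TopologicalSpace X] {x y z : X} (hxy : x ⤳ y)
    (hyz : y ⤳ z) {C D : Set X} (hC : IsClosed C) (hyC : y ∈ C) (hxC : x ∉ C) (hD : IsClosed D)
    (hzD : z ∈ D) (hyD : y ∉ D) : 2 ≤ topologicalKrullDim X := by
  let cl : X → IrreducibleCloseds X := fun x =>
    ⟨closure {x}, isIrreducible_singleton.closure, isClosed_closure⟩
  have hlt : ∀ {a b : X} {E : Set X}, a ⤳ b → IsClosed E → b ∈ E → a ∉ E → cl b < cl a := by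
    intro a b E hab hE hb ha
    refine lt_of_le_not_ge hab.closure_subset fun h => ha ?_
    exact closure_minimal (Set.singleton_subset_iff.2 hb) hE (h (subset_closure rfl))
  let p : LTSeries (IrreducibleCloseds X) :=
    { length := 2
      toFun := ![cl z, cl y, cl x]
      step := by
        intro i
        fin_cases i
        · exact hlt hyz hD hzD hyD
        · exact hlt hxy hC hyC hxC }
  exact Order.LTSeries.length_le_krullDim p

namespace RatModel

variable {S : Set Place} (M : RatModel (ArithPt S))

/-- The product of a curve with itself has dimension `2` if the stalks at the generic point and at
some closed point `v` have local morphisms to the rational numbers: it then contains the points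
with coordinates in `{generic, v}`. -/
theorem topologicalKrullDim_prod (v : S) (hg : M.HasLocalMapToRat .generic)
    (hv : M.HasLocalMapToRat (.closed v)) :
    topologicalKrullDim (LocBlprProd.Pt M.toLocBlprSp M.toLocBlprSp) = 2 := by
  let Z := LocBlprProd.Pt M.toLocBlprSp M.toLocBlprSp
  obtain ⟨ι, hind, hpt⟩ : ∃ ι : Z → ArithPt S × ArithPt S, Topology.IsInducing ι ∧
      ∀ x y : ArithPt S, M.HasLocalMapToRat x → M.HasLocalMapToRat y → ∃ z : Z, ι z = (x, y) := by
    refine ⟨fun z => z.1, Topology.IsInducing.subtypeVal, ?_⟩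
    rintro x y ⟨f, hf⟩ ⟨g, hg⟩
    exact ⟨⟨(x, y), ⟨⟨ratField, ratField.hasNonunitIdeal.isLocal, f, g, hf, hg⟩⟩⟩, rfl⟩
  refine le_antisymm (hind.topologicalKrullDim_le.trans ArithPt.topologicalKrullDim_prod_le) ?_
  obtain ⟨a, ha⟩ := hpt _ _ hg hg
  obtain ⟨b, hb⟩ := hpt _ _ hg hv
  obtain ⟨c, hc⟩ := hpt _ _ hv hv
  have h1 : a ⤳ b := by
    rw [← hind.specializes_iff]
    rw [ha, hb]
    exact (ArithPt.generic_specializes _).prod (ArithPt.generic_specializes _)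
  have h2 : b ⤳ c := by
    rw [← hind.specializes_iff]
    rw [hb, hc]
    exact (ArithPt.generic_specializes _).prod specializes_rfl
  have hcl := ArithPt.isClosed_singleton_closed v
  refine two_le_topologicalKrullDim h1 h2
    (hcl.preimage (continuous_snd.comp hind.continuous)) ?_ ?_
    (hcl.preimage (continuous_fst.comp hind.continuous)) ?_ ?_
  · simp [hb]
  · simp [ha]
  · simp [hc]
  · simp [hb]

theorem hasPullback_and_topologicalKrullDim (v : S) (hg : M.HasLocalMapToRat .generic)
    (hv : M.HasLocalMapToRat (.closed v)) :
    HasPullback M.toSpecF12 M.toSpecF12 ∧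
      ∀ (P : LocBlprSp) (p q : P ⟶ M.toLocBlprSp), IsPullback p q M.toSpecF12 M.toSpecF12 →
        topologicalKrullDim P.carrier = 2 := by
  have h := LocBlprProd.isPullback (X := M.toLocBlprSp) (Y := M.toLocBlprSp)
    M.hasNonunitIdeal_stalk M.hasNonunitIdeal_stalk M.toSpecF12 M.toSpecF12
    specF12.hom_subsingleton
  refine ⟨h.hasPullback, fun P p q h' => ?_⟩
  rw [← M.topologicalKrullDim_prod v hg hv]
  let e := h'.isoIsPullback _ _ h
  refine IsHomeomorph.topologicalKrullDim_eq e.hom.base ?_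
  refine isHomeomorph_iff_exists_inverse.2 ⟨e.hom.base.hom.continuous, e.inv.base, fun x => ?_,
    fun x => ?_, e.inv.base.hom.continuous⟩
  · exact congrArg (fun k : P ⟶ P => k.base x) e.hom_inv_id
  · exact congrArg (fun k : LocBlprProd.prod M.toLocBlprSp M.toLocBlprSp _ _ ⟶
      LocBlprProd.prod M.toLocBlprSp M.toLocBlprSp _ _ => k.base x) e.inv_hom_id

end RatModel

theorem mulModel.hasLocalMapToRat {S : Set Place} (x : ArithPt S) :
    (mulModel S).HasLocalMapToRat x := RatModel.hasLocalMapToRat_of_pre_eq rfl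

theorem mainTheorem2 :
    (HasPullback specZ.toF12 specZ.toF12 ∧
      ∀ (P : LocBlprSp) (p q : P ⟶ specZ), IsPullback p q specZ.toF12 specZ.toF12 →
        topologicalKrullDim P.carrier = 2) ∧
    (HasPullback specZBar.toF12 specZBar.toF12 ∧
      ∀ (P : LocBlprSp) (p q : P ⟶ specZBar), IsPullback p q specZBar.toF12 specZBar.toF12 →
        topologicalKrullDim P.carrier = 2) ∧
    (HasPullback specZBarRing.toF12 specZBarRing.toF12 ∧
      ∀ (P : LocBlprSp) (p q : P ⟶ specZBarRing),
        IsPullback p q specZBarRing.toF12 specZBarRing.toF12 →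
          topologicalKrullDim P.carrier = 2) := by
  refine ⟨?_, ?_, ?_⟩
  · exact RatModel.hasPullback_and_topologicalKrullDim _
      ⟨.finite ⟨2, Nat.prime_two⟩, by simp⟩ (mulModel.hasLocalMapToRat _)
      (mulModel.hasLocalMapToRat _)
  · exact RatModel.hasPullback_and_topologicalKrullDim _ ⟨.infinite, trivial⟩
      (mulModel.hasLocalMapToRat _) (mulModel.hasLocalMapToRat _)
  · exact RatModel.hasPullback_and_topologicalKrullDim _ ⟨.infinite, trivial⟩
      (RatModel.hasLocalMapToRat_of_eq_top rfl fun _ _ h => h)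
      (RatModel.hasLocalMapToRat_of_pre_eq rfl)
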